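/- **Setting.** An anytime-constrained Markov game $G$ with $n$ players consists of a finite set of $S$ states with an initial state $s_1$, finite nonempty action sets $\mathcal A_1,\dots,\mathcal A_n$ with $A=|\mathcal A_1\times\cdots\times\mathcal A_n|$ joint actions, a horizon $H$, a budget vector $B\in\mathbb R^n$ and, for $h\in[H]$, a state $s$ and a joint action $a$, a transition distribution $P_h(s,a)$, a reward distribution $R_h(s,a)$ on $\mathbb R^n$ with finite mean $r_h(s,a)$, and a cost distribution $C_h(s,a)$ on $\mathbb R^n$ with finite support. Joint policies $\pi$ map each history $\tau_h=(s_1,a_1,c_1,\dots,s_h)$ to a distribution on joint actions; $\bar c_h=\sum_{t<h}c_t$. For a history $\tau_h$, let $\Pi_G(\tau_h)$ be the set of policies $\pi$ such that, if play continues from $\tau_h$ according to $\pi$, almost surely $\sum_{t\le k}c_t\le B$ for all $k\in[H]$; let $\Pi_G=\Pi_G(s_1)$ be the set of feasible policies, and let $\mathcal F_h$ be the set of histories $\tau_h$ that have positive probability under some $\pi\in\Pi_G$. Let $V^\pi_{i,h}(\tau_h)$ be the expected total reward of player $i$ from time $h$ on when play continues from $\tau_h$ according to $\pi$. A deviation of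 player $i$ from $\pi$ is, for NE and CCE, a policy $(\pi_i',\pi_{-i})$, where $\pi'_i$ is an arbitrary history-dependent policy, played independently of the marginal $\pi_{-i}$ of $\pi$ on the other players' actions, and, for CE, a policy $\phi\circ\pi$, in which player $i$ replaces the action recommended to it by a (possibly randomized) function of the history and this action. An *ACSPE* (NE/CE/CCE) is a policy $\pi$ such that for all $h\in[H+1]$ and all $\tau_h\in\mathcal F_h$: $\pi\in\Pi_G(\tau_h)$, and $V_{i,h}^{\pi}(\tau_h)\ge V_{i,h}^{\pi'}(\tau_h)$ for every player $i$ and every deviation $\pi'$ of player $i$ with $\pi'\in\Pi_G(\tau_h)$; for NE, $\pi$ is in addition required to be a product policy. An *action-constrained Markov game* $\Gamma$ has finite state sets $\bar{\mathcal S}_h$, sets $\bar{\mathcal A}_h(x)\subseteq\mathcal A$ of allowed joint actions for $x\in\bar{\mathcal S}_h$, transition probabilities from $(h,x,a)$, $a\in\bar{\mathcal A}_h(x)$, to $\bar{\mathcal S}_{h+1}$, and expected rewards. A Markovian policy is feasible if at every time and state it plays allowed actions only; $\Gamma$ is feasible if such a policy exists. A *feasible MPE* (NE/CE/CCE) is a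 feasible Markovian policy $\bar\pi$ such that at every partial history $\bar\tau_h$ of $\Gamma$ no player $i$ has a (possibly history-dependent) deviation with higher value from $\bar\tau_h$ on among those that are feasible for the subgame at $\bar\tau_h$, i.e. that from $\bar\tau_h$ on almost surely play allowed actions only; for NE, $\bar\pi$ is in addition required to be a product policy. The *reduced game* $\overline G$ has $\bar{\mathcal S}_h=\{(s_h,\bar c_h):\tau_h\in\mathcal F_h\}$, initial state $(s_1,0)$, $\bar{\mathcal A}_h(s,\bar c)$ the set of joint actions taken with positive probability by some $\pi\in\Pi_G$ at a history $\tau_h$ that it realizes with $(s_h,\bar c_h)=(s,\bar c)$, transition probabilities $\bar P_h((s',\bar c+c)\mid(s,\bar c),a)=C_h(c\mid s,a)P_h(s'\mid s,a)$, and the rewards of $G$. **Algorithm.** The reduction first computes, time by time, the AND/OR graph with root $(1,s_1,0)$ in which an OR node $(h,s,\bar c)$ has one AND child $(h,s,\bar c,a)$ for every joint action $a$ such that $\bar c+c\le B$ for all $c$ in the support of $C_h(s,a)$, and $(h,s,\bar c,a)$ has the children $(h+1,s',\bar c+c)$ for $s'$, $c$ in the supports of $P_h(s,a)$, $C_h(s,a)$;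 nodes at time $H+1$ are TRUE and childless OR nodes at earlier times are FALSE. It evaluates the graph backward, returns "Infeasible" if the root is FALSE, and otherwise keeps only the nodes connected to the root through TRUE nodes. From them it writes down the tables of the reduced game, calls the subroutine MGSolve on this game, and returns the resulting policy $\bar\pi$, as a table of probabilities and read as the policy $\pi_h(\tau_h)=\bar\pi_h(s_h,\bar c_h)$ for $G$. Time is counted on a random access machine, where indices fit in one register, and numbers are either real numbers that fit in one register (unit cost) or rational numbers stored in binary (arithmetic being charged by bit length); $|G|$ and $|\Gamma|$ denote the corresponding total sizes of the tables describing the games. Let $D_G$ be the number of distinct vectors $\bar c_h\le B$, over all $h\in[H+1]$ and all histories $\tau_h$ that can occur in $G$. **Theorem (Reduction).** Let $\mathcal K$ be a class of action-constrained Markov games (for instance, the class of all of them). 1. Fix one of the notions NE, CE, CCE, and suppose that MGSolve returns a feasible MPE of this kind for every feasible game in $\mathcal K$. Then for every $G$: if $\Pi_G=\varnothing$, the reduction outputs "Infeasible"; if $\Pi_G\ne\varnothing$ and $\overline G\in\mathcal K$, it outputs an ACSPE of $G$ of this kind. 2. If, for some polynomial $p$, MGSolve takes at most $p(|\Gamma|)$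 steps on every feasible $\Gamma\in\mathcal K$, then there is a polynomial $q$ such that the reduction takes at most $q(|G|,D_G)$ steps on every $G$ (with rational data, in the case of binary numbers) for which $\Pi_G=\varnothing$ or $\overline G\in\mathcal K$. 3. Every output policy is stored in a table of at most $H\cdot S\cdot A\cdot D_G$ probabilities, one for each time, reduced state and joint action. -/

import Mathlib

open MeasureTheory

/-! ## Histories, policies and their laws

A history is the list (in chronological order) of the pairs (joint action, observation) produced so
far. Its length is the number of completed rounds, so the time index `h` of the usual one-based
convention is `length + 1`. -/

/-- Joint actions of `n` players, player `i` having the `k i` actions `0, …, k i - 1`. -/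
abbrev Joint {n : ℕ} (k : Fin n → ℕ) : Type := ∀ i : Fin n, Fin (k i)

namespace Play

/-- Finite histories of (action, observation) pairs. -/
abbrev Hist (A X : Type) : Type := List (A × X)

/-- History-dependent joint policies. -/
abbrev HPolicy (A X : Type) : Type := Hist A X → PMF A

/-- The law of the history after `m` further rounds, starting from the history `τ`, when actions are
drawn from `π` and observations from the kernel `K`. -/
noncomputable def rollout {A X : Type} (K : Hist A X → A → PMF X) (π : HPolicy A X) :
    ℕ → Hist A X → PMF (Hist A X)
  | 0, τ => PMF.pure τ
  | m + 1, τ => (π τ).bind fun a => (K τ a).bind fun x => rollout K π m (τ ++ [(a, x)])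

/-- The reward collected along `τ` from round `t` (zero-based) onward; `ρ σ a` is the (expected)
reward for playing `a` after the history `σ`. -/
noncomputable def gain {A X : Type} (ρ : Hist A X → A → ℝ) (t : ℕ) (τ : Hist A X) : ℝ :=
  ∑ j : Fin τ.length, if t ≤ (j : ℕ) then ρ (τ.take j) (τ.get j).1 else 0

/-- The expected reward collected from `τ` onward until round `H`, given `τ`. (All the laws used
below have finite support, so the sum is a finite one.) -/
noncomputable def value {A X : Type} (K : Hist A X → A → PMF X) (ρ : Hist A X → A → ℝ) (H : ℕ)
    (π : HPolicy A X) (τ : Hist A X) : ℝ :=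
  ∑' τ' : Hist A X, (rollout K π (H - τ.length) τ τ').toReal * gain ρ τ.length τ'

theorem finite_realizable {A X : Type} [Finite A] (K : Hist A X → A → PMF X)
    (hK : ∀ τ a, (K τ a).support.Finite) (m : ℕ) (τ : Hist A X) :
    {τ' | ∃ π : HPolicy A X, τ' ∈ (rollout K π m τ).support}.Finite := by
  induction m generalizing τ with
  | zero =>
    refine (Set.finite_singleton τ).subset ?_
    rintro τ' ⟨π, hπ⟩
    simpa [rollout] using hπ
  | succ m ih =>
    have hfin : (⋃ a : A, ⋃ x ∈ (K τ a).support,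
        {τ' | ∃ π : HPolicy A X, τ' ∈ (rollout K π m (τ ++ [(a, x)])).support}).Finite :=
      Set.finite_iUnion fun a => (hK τ a).biUnion fun x _ => ih _
    refine hfin.subset ?_
    rintro τ' ⟨π, hπ⟩
    simp only [rollout, PMF.mem_support_bind_iff] at hπ
    obtain ⟨a, -, x, hx, h⟩ := hπ
    exact Set.mem_iUnion.2 ⟨a, Set.mem_biUnion hx ⟨π, h⟩⟩

/-- A distribution on joint actions under which the players act independently. -/
def IsProductDist {n : ℕ} {k : Fin n → ℕ} (μ : PMF (Joint k)) : Prop :=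
  ∃ p : ∀ i, PMF (Fin (k i)), ∀ a, μ a = ∏ i, p i (a i)

/-- `(π_i', π_{-i})`: player `i` plays `π'` independently of the others, who play the marginal of `π`
on their actions. -/
noncomputable def deviate {n : ℕ} {k : Fin n → ℕ} {X : Type} (π : HPolicy (Joint k) X) (i : Fin n)
    (π' : Hist (Joint k) X → PMF (Fin (k i))) : HPolicy (Joint k) X := fun τ =>
  (π τ).bind fun a => (π' τ).map fun b => Function.update a i b

/-- `φ ∘ π`: player `i` replaces the action recommended to it by `π`, using the modification `φ`. -/
noncomputable def modify {n : ℕ} {k : Fin n → ℕ} {X : Type} (π : HPolicy (Joint k) X) (i : Fin n)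
    (φ : Hist (Joint k) X → Fin (k i) → PMF (Fin (k i))) : HPolicy (Joint k) X := fun τ =>
  (π τ).bind fun a => (φ τ (a i)).map fun b => Function.update a i b

/-- Nash, correlated, and coarse correlated equilibria. -/
inductive Kind
  | NE
  | CE
  | CCE

/-- The policies that arise from `π` by a deviation of player `i`. -/
def deviations {n : ℕ} {k : Fin n → ℕ} {X : Type} (kind : Kind) (π : HPolicy (Joint k) X)
    (i : Fin n) : Set (HPolicy (Joint k) X) :=
  match kind with
  | .NE => Set.range (deviate π i)
  | .CE => Set.range (modify π i)
  | .CCE => Set.range (deviate π i)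

end Play

/-! ## Cost models

Running times are counted for a random access machine. In the model `unit` every number fits in one
register (real-number machine); in the model `bit` numbers are rational and stored in binary.
Indices (states, actions, times, pointers) fit in one register in both models. -/

inductive CostModel
  | unit
  | bit

open Classical in
/-- Storage size of a number. In the model `bit` it is used for rational numbers only. -/
noncomputable def CostModel.numSize (ω : CostModel) (x : ℝ) : ℕ :=
  match ω with
  | .unit => 1
  | .bit => if h : ∃ q : ℚ, (q : ℝ) = x then h.choose.num.natAbs.size + h.choose.den.size + 1 else 1

/-- Time charged for an addition, a multiplication or a comparison of two numbers: constant in the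
model `unit`, and cubic in the bit length (enough for school-book rational arithmetic with reduction
of fractions) in the model `bit`. -/
noncomputable def CostModel.opCost (ω : CostModel) (x y : ℝ) : ℕ :=
  (ω.numSize x + ω.numSize y) ^ 3

/-- The numbers that the machine can store. -/
def CostModel.Stores (ω : CostModel) (x : ℝ) : Prop :=
  match ω with
  | .unit => True
  | .bit => ∃ q : ℚ, (q : ℝ) = x

/-- A computation: its result together with the number of elementary steps that it takes. -/
structure Timed (α : Type) where
  val : α
  time : ℕ

namespace Timed

instance : Monad Timed where
  pure a := ⟨a, 0⟩
  bind m f := ⟨(f m.val).val, m.time + (f m.val).time⟩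

/-- Spend `m` steps. -/
def tick (m : ℕ) : Timed Unit := ⟨(), m⟩

/-- Loop over a list with an accumulator; every iteration costs one step plus its body. -/
def fold {α β : Type} (f : β → α → Timed β) : β → List α → Timed β
  | b, [] => pure b
  | b, a :: l => do
    tick 1
    let b' ← f b a
    fold f b' l

/-- Does every entry of the list pass the test? -/
def all {α : Type} (p : α → Timed Bool) (l : List α) : Timed Bool :=
  fold (fun b a => do
    let c ← p a
    pure (b && c)) true l

/-- Does some entry of the list pass the test? -/
def any {α : Type} (p : α → Timed Bool) (l : List α) : Timed Bool :=
  fold (fun b a => do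
    let c ← p a
    pure (b || c)) false l

/-- The entries of the list that pass the test. -/
def filter {α : Type} (p : α → Timed Bool) : List α → Timed (List α)
  | [] => pure []
  | a :: l => do
    tick 1
    let c ← p a
    let r ← filter p l
    pure (if c then a :: r else r)

/-- A table with one row `f a` for every entry `a` of the list, and `d` (no row) elsewhere. -/
def tabulate {α β : Type} [DecidableEq α] (d : β) (f : α → Timed β) : List α → Timed (α → β)
  | [] => pure fun _ => d
  | a :: l => do
    tick 1
    let b ← f a
    let g ← tabulate d f l
    pure (Function.update g a b)

end Timed

/-! ## Action-constrained Markov games -/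

/-- The data of a finite-horizon action-constrained Markov game. Rounds are numbered `0, …, H - 1`;
`states t` is the set of states at round `t ≤ H`, `acts t x` the set of allowed joint actions,
`trans t x a` the table of transition probabilities and `r t x a i` the expected reward of player
`i`. The last two are used only for `t < H`, `x ∈ states t` and `a ∈ acts t x`: other joint actions
are forbidden (the reward `-∞` is expressed by the feasibility conditions below). -/
structure ACGame where
  n : ℕ
  k : Fin n → ℕ
  k_pos : ∀ i, 0 < k i
  H : ℕ
  State : Type
  s₁ : State
  states : ℕ → Finset State
  acts : ℕ → State → Finset (Joint k)
  trans : ℕ → State → Joint k → State →₀ ℝ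
  r : ℕ → State → Joint k → Fin n → ℝ

namespace ACGame

open Play

/-- The transition tables are probability distributions on the states of the next round. -/
def WellFormed (Γ : ACGame) : Prop :=
  Γ.s₁ ∈ Γ.states 0 ∧
  ∀ t < Γ.H, ∀ x ∈ Γ.states t, ∀ a ∈ Γ.acts t x,
    (∀ y, 0 ≤ Γ.trans t x a y) ∧ ((Γ.trans t x a).sum fun _ p => p) = 1 ∧
      (Γ.trans t x a).support ⊆ Γ.states (t + 1)

/-- Markovian joint policies, as tables with one row per round and state. -/
def Policy (Γ : ACGame) : Type :=
  (t : Fin Γ.H) → {x // x ∈ Γ.states t} → PMF (Joint Γ.k)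

/-- A policy is feasible if it only plays allowed actions, at every round and state. -/
def IsFeasiblePolicy (Γ : ACGame) (π : Γ.Policy) : Prop :=
  ∀ (t : Fin Γ.H) (x : {x // x ∈ Γ.states t}), (π t x).support ⊆ Γ.acts t x

def Feasible (Γ : ACGame) : Prop := ∃ π : Γ.Policy, Γ.IsFeasiblePolicy π

open Classical in
/-- Look up a row of a policy; where there is no row, a fixed joint action is played. -/
noncomputable def row (Γ : ACGame) (π : Γ.Policy) (t : ℕ) (x : Γ.State) : PMF (Joint Γ.k) :=
  if h : t < Γ.H ∧ x ∈ Γ.states t then π ⟨t, h.1⟩ ⟨x, h.2⟩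
  else PMF.pure fun i => ⟨0, Γ.k_pos i⟩

/-- The current state after a history. -/
def cur (Γ : ACGame) (τ : Hist (Joint Γ.k) Γ.State) : Γ.State :=
  (τ.getLast?.map Prod.snd).getD Γ.s₁

/-- A Markovian policy as a policy on histories. -/
noncomputable def toHPolicy (Γ : ACGame) (π : Γ.Policy) : HPolicy (Joint Γ.k) Γ.State :=
  fun τ => Γ.row π τ.length (Γ.cur τ)

open Classical in
/-- The transition kernel. For tables that are not distributions (which do not occur after an
allowed action in a well-formed game) the state does not change. -/
noncomputable def kernel (Γ : ACGame) (τ : Hist (Joint Γ.k) Γ.State) (a : Joint Γ.k) :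
    PMF Γ.State :=
  if h : ∑' y, ENNReal.ofReal (Γ.trans τ.length (Γ.cur τ) a y) = 1 then
    ⟨fun y => ENNReal.ofReal (Γ.trans τ.length (Γ.cur τ) a y),
      (Summable.hasSum_iff ENNReal.summable).2 h⟩
  else PMF.pure (Γ.cur τ)

/-- The expected reward of player `i` from the history `τ` onward, given `τ`. -/
noncomputable def value (Γ : ACGame) (i : Fin Γ.n) (π : HPolicy (Joint Γ.k) Γ.State)
    (τ : Hist (Joint Γ.k) Γ.State) : ℝ :=
  Play.value Γ.kernel (fun σ a => Γ.r σ.length (Γ.cur σ) a i) Γ.H π τ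

/-- Partial histories of the game: allowed actions, and states of the respective rounds. -/
def IsHistory (Γ : ACGame) (τ : Hist (Joint Γ.k) Γ.State) : Prop :=
  τ.length ≤ Γ.H ∧ ∀ j : Fin τ.length,
    (τ.get j).1 ∈ Γ.acts j (Γ.cur (τ.take j)) ∧ (τ.get j).2 ∈ Γ.states (j + 1)

/-- The policy `π` is feasible for the subgame at `τ`: almost surely, given `τ`, all actions played
from `τ` onward are allowed. -/
def SubgameFeasible (Γ : ACGame) (π : HPolicy (Joint Γ.k) Γ.State)
    (τ : Hist (Joint Γ.k) Γ.State) : Prop :=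
  (rollout Γ.kernel π (Γ.H - τ.length) τ).toOuterMeasure
    {τ' | ∀ j : Fin τ'.length, τ.length ≤ (j : ℕ) →
      (τ'.get j).1 ∈ Γ.acts j (Γ.cur (τ'.take j))} = 1

/-- Markov-perfect (Nash / correlated / coarse correlated) equilibria: a feasible Markovian policy
such that, in every subgame, no player gains by a (possibly history-dependent) deviation that is
feasible for that subgame. -/
structure IsMPE (Γ : ACGame) (kind : Kind) (π : Γ.Policy) : Prop where
  feasible : Γ.IsFeasiblePolicy π
  stable : ∀ (i : Fin Γ.n) (τ : Hist (Joint Γ.k) Γ.State), Γ.IsHistory τ →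
    ∀ π' ∈ deviations kind (Γ.toHPolicy π) i, Γ.SubgameFeasible π' τ →
      Γ.value i π' τ ≤ Γ.value i (Γ.toHPolicy π) τ
  product : kind = Kind.NE →
    ∀ (t : Fin Γ.H) (x : {x // x ∈ Γ.states t}), IsProductDist (π t x)

/-- Description size of the game (states are referred to by indices). -/
noncomputable def size (Γ : ACGame) (ω : CostModel) : ℕ :=
  Γ.H + Γ.n + ∑ i, Γ.k i + ∑ t ∈ Finset.range (Γ.H + 1), (Γ.states t).card +
  ∑ t ∈ Finset.range Γ.H, ∑ x ∈ Γ.states t,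
    (Fintype.card (Joint Γ.k) + ∑ a ∈ Γ.acts t x,
      (∑ i, ω.numSize (Γ.r t x a i) + (Γ.trans t x a).sum fun _ p => ω.numSize p))

end ACGame

/-! ## Anytime-constrained Markov games -/

/-- An anytime-constrained Markov game: `S` states, `k i` actions of player `i`, horizon `H`, budgets
`B`, and, for every round `t = 0, …, H - 1`, transition, reward and cost distributions (their values
at `t ≥ H` are never used). Costs have finite support, rewards have a finite mean. -/
structure ACMG where
  n : ℕ
  k : Fin n → ℕ
  k_pos : ∀ i, 0 < k i
  S : ℕ
  s₁ : Fin S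
  H : ℕ
  P : ℕ → Fin S → Joint k → PMF (Fin S)
  R : ℕ → Fin S → Joint k → Measure (Fin n → ℝ)
  R_prob : ∀ t s a, IsProbabilityMeasure (R t s a)
  R_int : ∀ t s a i, Integrable (fun v : Fin n → ℝ => v i) (R t s a)
  C : ℕ → Fin S → Joint k → PMF (Fin n → ℝ)
  C_fin : ∀ t s a, (C t s a).support.Finite
  B : Fin n → ℝ

namespace ACMG

open Play

/-- After each round the cost vector and the next state are observed. -/
abbrev Obs (G : ACMG) : Type := (Fin G.n → ℝ) × Fin G.S

/-- Pairs (state, cumulative cost). -/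
abbrev Node (G : ACMG) : Type := Fin G.S × (Fin G.n → ℝ)

/-- Expected rewards. -/
noncomputable def r (G : ACMG) (t : ℕ) (s : Fin G.S) (a : Joint G.k) (i : Fin G.n) : ℝ :=
  ∫ v, v i ∂(G.R t s a)

/-- The current state after a history. -/
def cur (G : ACMG) (τ : Hist (Joint G.k) G.Obs) : Fin G.S :=
  (τ.getLast?.map fun p => p.2.2).getD G.s₁

/-- The cumulative cost of a history. -/
def cum (G : ACMG) (τ : Hist (Joint G.k) G.Obs) : Fin G.n → ℝ :=
  (τ.map fun p => p.2.1).sum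

def node (G : ACMG) (τ : Hist (Joint G.k) G.Obs) : G.Node := (G.cur τ, G.cum τ)

/-- Cost and next state are drawn independently, given the current state and joint action. -/
noncomputable def kernel (G : ACMG) (τ : Hist (Joint G.k) G.Obs) (a : Joint G.k) : PMF G.Obs :=
  (G.C τ.length (G.cur τ) a).bind fun c => (G.P τ.length (G.cur τ) a).map fun s => (c, s)

theorem kernel_finite (G : ACMG) (τ : Hist (Joint G.k) G.Obs) (a : Joint G.k) :
    (G.kernel τ a).support.Finite := by
  unfold kernel
  rw [PMF.support_bind]
  refine (G.C_fin _ _ _).biUnion fun c _ => ?_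
  rw [PMF.support_map]
  exact (Set.toFinite _).image _

/-- The policies that are feasible for the subgame at `τ`: given `τ`, the cumulative costs after each
of the rounds `1, …, H` are within the budgets almost surely. -/
def subgamePolicies (G : ACMG) (τ : Hist (Joint G.k) G.Obs) : Set (HPolicy (Joint G.k) G.Obs) :=
  {π | (rollout G.kernel π (G.H - τ.length) τ).toOuterMeasure
    {τ' | ∀ m, 1 ≤ m → m ≤ G.H → G.cum (τ'.take m) ≤ G.B} = 1}

/-- The feasible policies of the game. -/
def feasiblePolicies (G : ACMG) : Set (HPolicy (Joint G.k) G.Obs) := G.subgamePolicies []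

/-- The policy `π` realizes the partial history `τ` with positive probability. -/
def Realizes (G : ACMG) (π : HPolicy (Joint G.k) G.Obs) (τ : Hist (Joint G.k) G.Obs) : Prop :=
  0 < rollout G.kernel π τ.length [] τ

/-- Partial histories realizable by some feasible policy. -/
def FeasiblyRealizable (G : ACMG) (τ : Hist (Joint G.k) G.Obs) : Prop :=
  τ.length ≤ G.H ∧ ∃ π ∈ G.feasiblePolicies, G.Realizes π τ

/-- The expected reward of player `i` from the history `τ` onward, given `τ`. -/
noncomputable def value (G : ACMG) (i : Fin G.n) (π : HPolicy (Joint G.k) G.Obs)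
    (τ : Hist (Joint G.k) G.Obs) : ℝ :=
  Play.value G.kernel (fun σ a => G.r σ.length (G.cur σ) a i) G.H π τ

/-- Anytime-constrained subgame-perfect (Nash / correlated / coarse correlated) equilibria. -/
structure IsACSPE (G : ACMG) (kind : Kind) (π : HPolicy (Joint G.k) G.Obs) : Prop where
  feasible : ∀ τ, G.FeasiblyRealizable τ → π ∈ G.subgamePolicies τ
  stable : ∀ τ, G.FeasiblyRealizable τ → ∀ i, ∀ π' ∈ deviations kind π i,
    π' ∈ G.subgamePolicies τ → G.value i π' τ ≤ G.value i π τ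
  product : kind = Kind.NE → ∀ τ, IsProductDist (π τ)

/-- The number of distinct cumulative costs within the budgets, over all histories that can occur. -/
noncomputable def D (G : ACMG) : ℕ :=
  {c | ∃ (π : HPolicy (Joint G.k) G.Obs) (τ : Hist (Joint G.k) G.Obs),
    τ.length ≤ G.H ∧ G.Realizes π τ ∧ G.cum τ = c ∧ c ≤ G.B}.ncard

/-! ### The reduced game -/

/-- (State, cumulative cost) pairs realizable by a feasible policy after `t` rounds. -/
def FS (G : ACMG) (t : ℕ) : Set G.Node :=
  {x | ∃ π ∈ G.feasiblePolicies, ∃ τ, τ.length = t ∧ G.Realizes π τ ∧ G.node τ = x}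

/-- Joint actions taken in round `t` by some feasible policy at the pair `x`. -/
def FA (G : ACMG) (t : ℕ) (x : G.Node) : Set (Joint G.k) :=
  {a | ∃ π ∈ G.feasiblePolicies, ∃ (τ : Hist (Joint G.k) G.Obs) (o : G.Obs),
    τ.length = t ∧ G.Realizes π (τ ++ [(a, o)]) ∧ G.node τ = x}

theorem FS_finite (G : ACMG) (t : ℕ) : (G.FS t).Finite := by
  refine ((Play.finite_realizable G.kernel G.kernel_finite t []).image G.node).subset ?_
  rintro x ⟨π, -, τ, rfl, h, rfl⟩
  exact ⟨τ, ⟨π, (PMF.mem_support_iff _ _).2 h.ne'⟩, rfl⟩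

/-- The finite list of costs that can be incurred in round `t` by playing `a` at `s`. -/
noncomputable def costs (G : ACMG) (t : ℕ) (s : Fin G.S) (a : Joint G.k) :
    Finset (Fin G.n → ℝ) := (G.C_fin t s a).toFinset

/-- Tables describing an action-constrained game on the pairs (state, cumulative cost). -/
structure Tables (G : ACMG) where
  states : ℕ → Finset G.Node
  acts : ℕ → G.Node → Finset (Joint G.k)
  trans : ℕ → G.Node → Joint G.k → G.Node →₀ ℝ
  r : ℕ → G.Node → Joint G.k → Fin G.n → ℝ

/-- The action-constrained game described by the tables, with initial state `(s₁, 0)`. -/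
def Tables.game {G : ACMG} (T : Tables G) : ACGame where
  n := G.n
  k := G.k
  k_pos := G.k_pos
  H := G.H
  State := G.Node
  s₁ := (G.s₁, 0)
  states := T.states
  acts := T.acts
  trans := T.trans
  r := T.r

open Classical in
/-- The reduced game: the states are the feasible pairs, the allowed actions are the feasible ones,
the probability of moving from `(s, c̄)` to `(s', c̄ + c)` is the probability of incurring `c` times
that of moving to `s'`, and the rewards are those of `G`. No entries are kept for pairs or actions
outside of the game. -/
noncomputable def reducedGame (G : ACMG) : ACGame :=
  Tables.game (G := G)
    { states := fun t => if t ≤ G.H then (G.FS_finite t).toFinset else ∅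
      acts := fun t x => if t < G.H then Finset.univ.filter fun a => a ∈ G.FA t x else ∅
      trans := fun t x a =>
        if t < G.H ∧ x ∈ G.FS t ∧ a ∈ G.FA t x then
          ∑ c ∈ G.costs t x.1 a, ∑ s : Fin G.S,
            Finsupp.single (s, x.2 + c) ((G.C t x.1 a c).toReal * (G.P t x.1 a s).toReal)
        else 0
      r := fun t x a => if t < G.H ∧ x ∈ G.FS t ∧ a ∈ G.FA t x then G.r t x.1 a else 0 }

/-! ### Description size -/

/-- Description size of the game: the sizes of all its tables. -/
noncomputable def size (G : ACMG) (ω : CostModel) : ℕ :=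
  G.H + G.S + G.n + ∑ i, G.k i + ∑ i, ω.numSize (G.B i) +
  ∑ t ∈ Finset.range G.H, ∑ s, ∑ a,
    (1 + ∑ s', ω.numSize (G.P t s a s').toReal + ∑ i, ω.numSize (G.r t s a i) +
      ∑ c ∈ G.costs t s a, (ω.numSize (G.C t s a c).toReal + ∑ i, ω.numSize (c i)))

/-- All numbers in the description of the game can be stored. -/
def StoredIn (G : ACMG) (ω : CostModel) : Prop :=
  (∀ i, ω.Stores (G.B i)) ∧
  ∀ t < G.H, ∀ s a, (∀ s', ω.Stores (G.P t s a s').toReal) ∧ (∀ i, ω.Stores (G.r t s a i)) ∧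
    ∀ c ∈ G.costs t s a, ω.Stores (G.C t s a c).toReal ∧ ∀ i, ω.Stores (c i)

/-! ### The algorithm -/

section Algorithm

/-- Size of a pair (state, cumulative cost). -/
noncomputable def nodeSize {G : ACMG} (ω : CostModel) (x : G.Node) : ℕ :=
  1 + ∑ i, ω.numSize (x.2 i)

noncomputable def addCost {G : ACMG} (ω : CostModel) (c d : Fin G.n → ℝ) :
    Timed (Fin G.n → ℝ) :=
  ⟨c + d, 1 + ∑ i, ω.opCost (c i) (d i)⟩

open Classical in
noncomputable def withinBudget {G : ACMG} (ω : CostModel) (c : Fin G.n → ℝ) : Timed Bool :=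
  ⟨decide (c ≤ G.B), 1 + ∑ i, ω.opCost (c i) (G.B i)⟩

noncomputable def sameNode {G : ACMG} (ω : CostModel) (x y : G.Node) : Timed Bool :=
  ⟨decide (x = y), 1 + ∑ i, ω.opCost (x.2 i) (y.2 i)⟩

noncomputable def isPositive (ω : CostModel) (p : ℝ) : Timed Bool :=
  ⟨decide (0 < p), ω.numSize p⟩

noncomputable def mulNum (ω : CostModel) (p q : ℝ) : Timed ℝ := ⟨p * q, ω.opCost p q⟩

noncomputable def memList {G : ACMG} (ω : CostModel) (x : G.Node) (L : List G.Node) :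
    Timed Bool :=
  Timed.any (fun y => sameNode ω x y) L

noncomputable def insertList {G : ACMG} (ω : CostModel) (L : List G.Node) (x : G.Node) :
    Timed (List G.Node) := do
  let b ← memList ω x L
  if b then pure L else do
    Timed.tick (nodeSize ω x)
    pure (x :: L)

/-- List of all joint actions. -/
noncomputable def jointList (G : ACMG) : List (Joint G.k) := Finset.univ.toList

/-- List of all states. -/
noncomputable def stateList (G : ACMG) : List (Fin G.S) := Finset.univ.toList

/-- Is `a` a feasible action at `x`, i.e. does no realization violate a budget immediately? -/
noncomputable def feasibleAction (G : ACMG) (ω : CostModel) (t : ℕ) (x : G.Node) (a : Joint G.k) :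
    Timed Bool :=
  Timed.all (fun c => do
    let c' ← addCost ω x.2 c
    withinBudget ω c') (G.costs t x.1 a).toList

/-- The children of the AND node `(t, x, a)`. -/
noncomputable def children (G : ACMG) (ω : CostModel) (t : ℕ) (x : G.Node) (a : Joint G.k) :
    Timed (List G.Node) :=
  Timed.fold (fun acc c => do
    let c' ← addCost ω x.2 c
    Timed.fold (fun acc s => do
      let b ← isPositive ω (G.P t x.1 a s).toReal
      if b then do
        Timed.tick (nodeSize (G := G) ω (s, c'))
        pure ((s, c') :: acc)
      else pure acc) acc G.stateList) [] (G.costs t x.1 a).toList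

/-- All children, without repetitions, of the nodes `x` in `L` under the actions that pass `ok x`. -/
noncomputable def expand (G : ACMG) (ω : CostModel) (t : ℕ) (ok : G.Node → Joint G.k → Timed Bool)
    (L : List G.Node) : Timed (List G.Node) :=
  Timed.fold (fun acc x =>
    Timed.fold (fun acc a => do
      let b ← ok x a
      if b then do
        let ys ← G.children ω t x a
        Timed.fold (insertList ω) acc ys
      else pure acc) acc G.jointList) [] L

/-- Construction of the AND/OR graph: the OR nodes at the rounds `t, …, t + m`, given those at round
`t`. -/
noncomputable def forward (G : ACMG) (ω : CostModel) :
    ℕ → ℕ → List G.Node → Timed (List (List G.Node))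
  | 0, _, L => pure [L]
  | m + 1, t, L => do
    let L' ← G.expand ω t (G.feasibleAction ω t) L
    let rest ← forward G ω m (t + 1) L'
    pure (L :: rest)

/-- Is the AND node `(t, x, a)` in the graph and TRUE, where `T` lists the TRUE nodes at round
`t + 1`? -/
noncomputable def trueAction (G : ACMG) (ω : CostModel) (t : ℕ) (T : List G.Node) (x : G.Node)
    (a : Joint G.k) : Timed Bool := do
  let b ← G.feasibleAction ω t x a
  if b then do
    let ys ← G.children ω t x a
    Timed.all (fun y => memList ω y T) ys
  else pure false

/-- Evaluation of the AND/OR graph: the TRUE nodes at each round, given the list of the layers from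
round `t` to the last one, whose nodes are all TRUE. -/
noncomputable def evaluate (G : ACMG) (ω : CostModel) :
    ℕ → List (List G.Node) → Timed (List (List G.Node))
  | _, [] => pure []
  | t, L :: Ls =>
    match Ls with
    | [] => pure [L]
    | _ :: _ => do
      let Ts ← evaluate G ω (t + 1) Ls
      let T ← Timed.filter (fun x =>
        Timed.any (fun a => G.trueAction ω t (Ts.headD []) x a) G.jointList) L
      pure (T :: Ts)

/-- Pruning: the nodes at the rounds from `t` on that are connected to the nodes in `L` at round `t`
through TRUE nodes only; the second list contains the TRUE nodes at the rounds `t + 1, …`. -/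
noncomputable def prune (G : ACMG) (ω : CostModel) :
    ℕ → List G.Node → List (List G.Node) → Timed (List (List G.Node))
  | _, L, [] => pure [L]
  | t, L, T :: Ts => do
    let L' ← G.expand ω t (G.trueAction ω t T) L
    let rest ← prune G ω (t + 1) L' Ts
    pure (L :: rest)

/-- The output of the feasibility computation: states and actions. -/
structure FeasibleSets (G : ACMG) where
  RS : ℕ → List G.Node
  RA : ℕ → G.Node → List (Joint G.k)

/-- The feasibility computation; `none` stands for "Infeasible". -/
noncomputable def feasibility (G : ACMG) (ω : CostModel) : Timed (Option G.FeasibleSets) := do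
  let layers ← G.forward ω G.H 0 [(G.s₁, 0)]
  let Ts ← G.evaluate ω 0 layers
  let b ← memList (G := G) ω (G.s₁, 0) (Ts.headD [])
  if b then do
    let RS ← G.prune ω 0 [(G.s₁, 0)] Ts.tail
    let RA ← Timed.tabulate (fun _ => []) (fun t =>
      Timed.tabulate [] (fun x =>
        Timed.filter (G.trueAction ω t (Ts.getD (t + 1) []) x) G.jointList)
        (RS.getD t [])) (List.range G.H)
    pure (some ⟨fun t => RS.getD t [], RA⟩)
  else pure none

/-- One row of the transition table of the reduced game. -/
noncomputable def transRow (G : ACMG) (ω : CostModel) (t : ℕ) (x : G.Node) (a : Joint G.k) :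
    Timed (G.Node →₀ ℝ) :=
  Timed.fold (fun w c => do
    let c' ← addCost ω x.2 c
    Timed.fold (fun w s => do
      let p ← mulNum ω (G.C t x.1 a c).toReal (G.P t x.1 a s).toReal
      Timed.tick (nodeSize (G := G) ω (s, c') + ω.numSize p)
      pure (w + Finsupp.single (s, c') p)) w G.stateList) 0 (G.costs t x.1 a).toList

/-- One row of the reward table of the reduced game (a copy of the one of `G`). -/
noncomputable def rewardRow (G : ACMG) (ω : CostModel) (t : ℕ) (x : G.Node) (a : Joint G.k) :
    Timed (Fin G.n → ℝ) :=
  ⟨G.r t x.1 a, 1 + ∑ i, ω.numSize (G.r t x.1 a i)⟩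

/-- Construction of the tables of the reduced game from the feasible sets (the lists in `F` have no
repetitions and serve as the finite sets of states and actions). -/
noncomputable def construct (G : ACMG) (ω : CostModel) (F : G.FeasibleSets) :
    Timed G.Tables := do
  let trans ← Timed.tabulate (fun _ _ => 0) (fun t =>
    Timed.tabulate (fun _ => 0) (fun x =>
      Timed.tabulate 0 (G.transRow ω t x) (F.RA t x)) (F.RS t)) (List.range G.H)
  let r ← Timed.tabulate (fun _ _ => 0) (fun t =>
    Timed.tabulate (fun _ => 0) (fun x =>
      Timed.tabulate 0 (G.rewardRow ω t x) (F.RA t x)) (F.RS t)) (List.range G.H)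
  pure
    { states := fun t => (F.RS t).toFinset
      acts := fun t x => (F.RA t x).toFinset
      trans := trans
      r := r }

/-- An output other than "Infeasible": a Markovian policy for a game on the pairs (state, cumulative
cost), stored as a table. -/
structure Output (G : ACMG) where
  tables : G.Tables
  table : tables.game.Policy

/-- The output as a history-dependent policy for `G`: track the cumulative cost and look up the row
of the current pair (state, cumulative cost). -/
noncomputable def Output.policy {G : ACMG} (o : G.Output) : HPolicy (Joint G.k) G.Obs :=
  fun τ => o.tables.game.row o.table τ.length (G.node τ)

/-- The number of probabilities stored in the output table: one for every round, state of that round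
and joint action. -/
def Output.space {G : ACMG} (o : G.Output) : ℕ :=
  ∑ t ∈ Finset.range G.H, (o.tables.states t).card * Fintype.card (Joint G.k)

/-- The reduction: compute the feasible sets, build the reduced game, and solve it by calling the
subroutine `MGSolve`; `none` stands for "Infeasible". -/
noncomputable def reduction (ω : CostModel) (MGSolve : (Γ : ACGame) → Timed Γ.Policy) (G : ACMG) :
    Timed (Option G.Output) := do
  let x ← G.feasibility ω
  match x with
  | none => pure none
  | some F => do
    let T ← G.construct ω F
    let π ← MGSolve T.game
    pure (some ⟨T, π⟩)

end Algorithm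

end ACMG

/-! Whether play can continue within the budgets depends on a history only through its node, the
pair (state, cumulative cost). A node is `Live` if some action respects the budgets for every cost
in its support and leads only to live nodes; such an action is `Safe`. A policy that keeps the
budgets up to the horizon plays only safe actions (`Abides.safe`), and a policy that plays only safe
actions at safely reachable nodes keeps the budgets (`abides_of_safe`). Hence, if the root is live,
the uniform policy on safe actions is feasible. It also realizes every safely reachable node, so the
states and actions of the reduced game are described by `Reach` and `Safe` (`mem_FS`, `mem_FA`).

Costs and cumulative costs determine each other, which gives a bijection `histEquiv` between
histories of G and histories on nodes. Along safe actions it respects transitions and rewards, hence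
the laws and values of policies that keep the budgets (`rollout_transport`, `Abides.value_eq`).
Deviations are defined history by history, so they are transported too. A profitable feasible
deviation in G would then be a profitable feasible deviation in the reduced game
(`isACSPE_of_isMPE`).

The forward pass of the algorithm finds the nodes reachable through affordable actions, the backward
pass selects the live ones, and pruning keeps those reachable through safe actions. The tables
written down are equal to those of the reduced game (`construct_val`), so the assumption on the
solver applies to them.

For the running time, a layer of the graph has at most S(D + 1) nodes, because beyond the root every
cumulative cost is counted by D. In the binary model a cumulative cost is a sum of at most H
rationals and has polynomial length (`numSize_cum_le`). Every relevant quantity is thus at most a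
power of N = |G| + D + 16 (`bound_of_stored`), and nested loops multiply such bounds. The reduced
game has size at most N ^ 20 (`reduced_size`), which leads to q = N ^ 41 + p(N ^ 20). -/

namespace Play

/-! ### Supports of the laws of play. -/

variable {A X : Type}

/-- The definition peels off the first round. Arguments about realized histories, which grow at the
end, need the last round peeled off instead. -/
theorem rollout_succ_last (K : Hist A X → A → PMF X) (π : HPolicy A X) (m : ℕ) (τ : Hist A X) :
    rollout K π (m + 1) τ = (rollout K π m τ).bind fun σ =>
      (π σ).bind fun a => (K σ a).bind fun x => PMF.pure (σ ++ [(a, x)]) := by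
  induction m generalizing τ with
  | zero => simp [rollout]
  | succ m ih =>
    change ((π τ).bind fun a => (K τ a).bind fun x => rollout K π (m + 1) (τ ++ [(a, x)])) =
      ((π τ).bind fun a => (K τ a).bind fun x => rollout K π m (τ ++ [(a, x)])).bind _
    simp only [ih, PMF.bind_bind]

theorem mem_rollout_succ {K : Hist A X → A → PMF X} {π : HPolicy A X} {m : ℕ} {τ τ' : Hist A X} :
    τ' ∈ (rollout K π (m + 1) τ).support ↔ ∃ a ∈ (π τ).support, ∃ x ∈ (K τ a).support,
      τ' ∈ (rollout K π m (τ ++ [(a, x)])).support := by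
  simp only [rollout, PMF.mem_support_bind_iff]

theorem mem_rollout_succ_last {K : Hist A X → A → PMF X} {π : HPolicy A X} {m : ℕ}
    {τ τ' : Hist A X} :
    τ' ∈ (rollout K π (m + 1) τ).support ↔ ∃ σ ∈ (rollout K π m τ).support,
      ∃ a ∈ (π σ).support, ∃ x ∈ (K σ a).support, τ' = σ ++ [(a, x)] := by
  simp only [rollout_succ_last, PMF.mem_support_bind_iff, PMF.mem_support_pure_iff]

theorem prefix_of_mem_rollout {K : Hist A X → A → PMF X} {π : HPolicy A X} {m : ℕ}
    {τ τ' : Hist A X} (h : τ' ∈ (rollout K π m τ).support) :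
    τ <+: τ' ∧ τ'.length = τ.length + m := by
  induction m generalizing τ' with
  | zero =>
    rw [rollout, PMF.mem_support_pure_iff] at h
    subst h; exact ⟨List.prefix_refl _, rfl⟩
  | succ m ih =>
    obtain ⟨σ, hσ, a, -, x, -, rfl⟩ := mem_rollout_succ_last.1 h
    obtain ⟨h1, h2⟩ := ih hσ
    exact ⟨h1.trans (List.prefix_append _ _), by simp [h2]; omega⟩

theorem take_of_mem_rollout {K : Hist A X → A → PMF X} {π : HPolicy A X} {m : ℕ}
    {τ τ' : Hist A X} (h : τ' ∈ (rollout K π m τ).support) : τ'.take τ.length = τ :=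
  (List.prefix_iff_eq_take.1 (prefix_of_mem_rollout h).1).symm

/-- Needed because the kernels of the two games agree only after safe actions, that is, only on the
supports that occur. -/
theorem bind_congr_support {α β : Type} (p : PMF α) {f g : α → PMF β}
    (h : ∀ a ∈ p.support, f a = g a) : p.bind f = p.bind g := by
  ext b
  simp only [PMF.bind_apply]
  refine tsum_congr fun a => ?_
  by_cases ha : p a = 0
  · simp [ha]
  · rw [h a ((PMF.mem_support_iff _ _).2 ha)]

end Play

/-! ### Live nodes, safe actions and feasible policies. -/

namespace ACMG

open Play

variable (G : ACMG)

@[simp] theorem cur_nil : G.cur [] = G.s₁ := rfl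

@[simp] theorem cum_nil : G.cum [] = 0 := rfl

@[simp] theorem cur_append (τ : Hist (Joint G.k) G.Obs) (a : Joint G.k) (o : G.Obs) :
    G.cur (τ ++ [(a, o)]) = o.2 := by simp [cur]

@[simp] theorem cum_append (τ : Hist (Joint G.k) G.Obs) (a : Joint G.k) (o : G.Obs) :
    G.cum (τ ++ [(a, o)]) = G.cum τ + o.1 := by simp [cum]

theorem node_append (τ : Hist (Joint G.k) G.Obs) (a : Joint G.k) (o : G.Obs) :
    G.node (τ ++ [(a, o)]) = (o.2, (G.node τ).2 + o.1) := by simp [node]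

@[simp] theorem mem_costs (t : ℕ) (s : Fin G.S) (a : Joint G.k) (c : Fin G.n → ℝ) :
    c ∈ G.costs t s a ↔ G.C t s a c ≠ 0 := by simp [costs, PMF.mem_support_iff]

theorem kernel_apply (τ : Hist (Joint G.k) G.Obs) (a : Joint G.k) (o : G.Obs) :
    G.kernel τ a o = G.C τ.length (G.cur τ) a o.1 * G.P τ.length (G.cur τ) a o.2 := by
  obtain ⟨c, s⟩ := o
  rw [kernel, PMF.bind_apply, tsum_eq_single c]
  · congr 1
    rw [PMF.map_apply, tsum_eq_single s]
    · simp
    · intro s' hs'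
      simp [Ne.symm hs']
  · intro c' hc'
    rw [PMF.map_apply]
    simp [Ne.symm hc']

theorem mem_kernel {τ : Hist (Joint G.k) G.Obs} {a : Joint G.k} {o : G.Obs} :
    o ∈ (G.kernel τ a).support ↔
      o.1 ∈ G.costs τ.length (G.node τ).1 a ∧ G.P τ.length (G.node τ).1 a o.2 ≠ 0 := by
  rw [PMF.mem_support_iff, kernel_apply, mem_costs, mul_ne_zero_iff]; rfl

/-- OR nodes at round `t` from which play can go on for `m` rounds within the budgets. -/
def Live : ℕ → ℕ → G.Node → Prop
  | 0, _, _ => True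
  | m + 1, t, x => ∃ a, ∀ c ∈ G.costs t x.1 a, x.2 + c ≤ G.B ∧
      ∀ s, G.P t x.1 a s ≠ 0 → Live m (t + 1) (s, x.2 + c)

/-- Actions that violate no budget immediately. -/
def Affordable (t : ℕ) (x : G.Node) (a : Joint G.k) : Prop :=
  ∀ c ∈ G.costs t x.1 a, x.2 + c ≤ G.B

/-- Actions that violate no budget immediately and lead to live nodes. -/
def Safe (t : ℕ) (x : G.Node) (a : Joint G.k) : Prop :=
  ∀ c ∈ G.costs t x.1 a, x.2 + c ≤ G.B ∧
    ∀ s, G.P t x.1 a s ≠ 0 → G.Live (G.H - (t + 1)) (t + 1) (s, x.2 + c)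

theorem Safe.affordable {G : ACMG} {t : ℕ} {x : G.Node} {a : Joint G.k} (h : G.Safe t x a) :
    G.Affordable t x a := fun c hc => (h c hc).1

theorem live_iff_exists_safe {t : ℕ} (ht : t < G.H) (x : G.Node) :
    G.Live (G.H - t) t x ↔ ∃ a, G.Safe t x a := by
  have h : G.H - t = (G.H - (t + 1)) + 1 := by omega
  rw [h]; rfl

/-- Nodes reachable from the root through actions that satisfy `ok`. -/
inductive Reach (ok : ℕ → G.Node → Joint G.k → Prop) : ℕ → G.Node → Prop
  | root : Reach ok 0 (G.s₁, 0)
  | step {t x a c s} : Reach ok t x → ok t x a → c ∈ G.costs t x.1 a → G.P t x.1 a s ≠ 0 →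
      Reach ok (t + 1) (s, x.2 + c)

variable {G}

theorem Reach.mono {ok ok' : ℕ → G.Node → Joint G.k → Prop} (h : ∀ t x a, ok t x a → ok' t x a)
    {t : ℕ} {x : G.Node} (hx : G.Reach ok t x) : G.Reach ok' t x := by
  induction hx with
  | root => exact .root
  | step _ ha hc hs ih => exact .step ih (h _ _ _ ha) hc hs

theorem Reach.append {ok : ℕ → G.Node → Joint G.k → Prop} {τ : Hist (Joint G.k) G.Obs}
    {a : Joint G.k} {o : G.Obs} (hτ : G.Reach ok τ.length (G.node τ))
    (ha : ok τ.length (G.node τ) a) (ho : o ∈ (G.kernel τ a).support) :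
    G.Reach ok (τ ++ [(a, o)]).length (G.node (τ ++ [(a, o)])) := by
  rw [node_append, List.length_append]
  exact .step hτ ha (G.mem_kernel.1 ho).1 (G.mem_kernel.1 ho).2

/-- Safety of the last action already contains liveness of its successors, so no induction is
needed; only the root uses `h0`. -/
theorem Reach.live (h0 : G.Live G.H 0 (G.s₁, 0)) {t : ℕ} {x : G.Node}
    (hx : G.Reach G.Safe t x) : G.Live (G.H - t) t x := by
  cases hx with
  | root => exact h0
  | step _ ha hc hs => exact (ha _ hc).2 _ hs

variable (G) in
/-- In the next `m` rounds after `τ`, the policy stays within the budgets almost surely. -/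
def Abides (π : HPolicy (Joint G.k) G.Obs) : ℕ → Hist (Joint G.k) G.Obs → Prop
  | 0, _ => True
  | m + 1, τ => ∀ a ∈ (π τ).support, ∀ o ∈ (G.kernel τ a).support,
      G.cum τ + o.1 ≤ G.B ∧ Abides π m (τ ++ [(a, o)])

/-- Turns the almost-sure condition on whole trajectories into the recursive one, on which all
inductions run. Prefixes up to `τ` itself are left out. -/
theorem abides_iff (π : HPolicy (Joint G.k) G.Obs) (m : ℕ) (τ : Hist (Joint G.k) G.Obs) :
    G.Abides π m τ ↔ ∀ τ' ∈ (rollout G.kernel π m τ).support,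
      ∀ j, τ.length < j → j ≤ τ.length + m → G.cum (τ'.take j) ≤ G.B := by
  induction m generalizing τ with
  | zero =>
    simp only [Abides, true_iff]
    intro τ' _ j h1 h2; omega
  | succ m ih =>
    simp only [Abides, mem_rollout_succ]
    constructor
    · rintro h τ' ⟨a, ha, o, ho, h'⟩ j h1 h2
      obtain ⟨hb, hab⟩ := h a ha o ho
      rcases (Nat.succ_le_of_lt h1).eq_or_lt with rfl | h3
      · have := take_of_mem_rollout h'
        simp only [List.length_append, List.length_singleton] at this
        rw [Nat.succ_eq_add_one, this, cum_append]
        exact hb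
      · exact (ih _).1 hab τ' h' j (by simpa using h3) (by simp; omega)
    · intro h a ha o ho
      constructor
      · obtain ⟨τ', h'⟩ := (rollout G.kernel π m (τ ++ [(a, o)])).support_nonempty
        have := take_of_mem_rollout h'
        simp only [List.length_append, List.length_singleton] at this
        have h2 := h τ' ⟨a, ha, o, ho, h'⟩ (τ.length + 1) (by omega) (by omega)
        rwa [this, cum_append] at h2
      · refine (ih _).2 fun τ' h' j h1 h2 => h τ' ⟨a, ha, o, ho, h'⟩ j ?_ ?_ <;>
          simp at h1 h2 <;> omega

/-- All trajectories extend `τ`, so the condition splits into a deterministic part on prefixes of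
`τ` and a part on the future. -/
theorem mem_subgamePolicies {π : HPolicy (Joint G.k) G.Obs} {τ : Hist (Joint G.k) G.Obs}
    (hτ : τ.length ≤ G.H) :
    π ∈ G.subgamePolicies τ ↔
      (∀ j, 1 ≤ j → j ≤ τ.length → G.cum (τ.take j) ≤ G.B) ∧
        G.Abides π (G.H - τ.length) τ := by
  rw [subgamePolicies, Set.mem_ofPred_eq, PMF.toOuterMeasure_apply_eq_one_iff, abides_iff]
  constructor
  · intro h
    refine ⟨fun j h1 h2 => ?_, fun τ' h' j h1 h2 => h h' j (by omega) (by omega)⟩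
    obtain ⟨τ', h'⟩ := (rollout G.kernel π (G.H - τ.length) τ).support_nonempty
    have := h h' j h1 (by omega)
    rwa [← take_of_mem_rollout h', List.take_take, min_eq_left h2]
  · rintro ⟨h1, h2⟩ τ' h' j hj1 hj2
    rcases le_or_gt j τ.length with hj | hj
    · have := h1 j hj1 hj
      rwa [← take_of_mem_rollout h', List.take_take, min_eq_left hj] at this
    · exact h2 τ' h' j hj (by omega)

theorem mem_feasiblePolicies {π : HPolicy (Joint G.k) G.Obs} :
    π ∈ G.feasiblePolicies ↔ G.Abides π G.H [] := by
  rw [feasiblePolicies, mem_subgamePolicies (Nat.zero_le _)]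
  simp
  intro _ j h1 h2; omega

theorem Abides.live {π : HPolicy (Joint G.k) G.Obs} {m : ℕ} {τ : Hist (Joint G.k) G.Obs}
    (h : G.Abides π m τ) : G.Live m τ.length (G.node τ) := by
  induction m generalizing τ with
  | zero => trivial
  | succ m ih =>
    obtain ⟨a, ha⟩ := (π τ).support_nonempty
    refine ⟨a, fun c hc => ?_⟩
    have key := fun s hs => h a ha (c, s) (G.mem_kernel.2 ⟨hc, hs⟩)
    -- The budget condition on a cost is stated without a next state, but `Abides` yields it only
    -- together with one.
    obtain ⟨s, hs⟩ := (G.P τ.length (G.node τ).1 a).support_nonempty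
    refine ⟨(key s hs).1, fun s hs => ?_⟩
    simpa [node] using ih (key s hs).2

theorem Abides.safe {π : HPolicy (Joint G.k) G.Obs} {m : ℕ} {τ : Hist (Joint G.k) G.Obs}
    (h : G.Abides π (m + 1) τ) (hm : τ.length + (m + 1) = G.H) {a : Joint G.k}
    (ha : a ∈ (π τ).support) : G.Safe τ.length (G.node τ) a := by
  intro c hc
  have key := fun s hs => h a ha (c, s) (G.mem_kernel.2 ⟨hc, hs⟩)
  obtain ⟨s, hs⟩ := (G.P τ.length (G.node τ).1 a).support_nonempty
  refine ⟨(key s hs).1, fun s hs => ?_⟩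
  have := (key s hs).2.live
  rw [show G.H - (τ.length + 1) = m by omega]
  simpa [node] using this

/-- Safe actions lead to safely reachable nodes, so the policy is never consulted elsewhere. This
matters because a policy table of the reduced game has rows only for such nodes. -/
theorem abides_of_safe {π : HPolicy (Joint G.k) G.Obs}
    (hπ : ∀ τ : Hist (Joint G.k) G.Obs, τ.length < G.H → G.Reach G.Safe τ.length (G.node τ) →
      ∀ a ∈ (π τ).support, G.Safe τ.length (G.node τ) a)
    {m : ℕ} {τ : Hist (Joint G.k) G.Obs} (hm : τ.length + m ≤ G.H)
    (hτ : G.Reach G.Safe τ.length (G.node τ)) : G.Abides π m τ := by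
  induction m generalizing τ with
  | zero => trivial
  | succ m ih =>
    intro a ha o ho
    have hs := hπ τ (by omega) hτ a ha
    exact ⟨(hs _ (G.mem_kernel.1 ho).1).1, ih (by simp; omega) (hτ.append hs ho)⟩

/-- All rounds played under a policy that stays within the budgets use safe actions. -/
theorem Abides.steps {π : HPolicy (Joint G.k) G.Obs} {m m' : ℕ} {τ τ' : Hist (Joint G.k) G.Obs}
    (h : G.Abides π m τ) (hm : τ.length + m = G.H) (hm' : m' ≤ m)
    (hτ : G.Reach G.Safe τ.length (G.node τ)) (h' : τ' ∈ (rollout G.kernel π m' τ).support) :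
    G.Reach G.Safe τ'.length (G.node τ') ∧ G.Abides π (m - m') τ' ∧
      ∀ j (hj : j < τ'.length), τ.length ≤ j →
        G.Reach G.Safe j (G.node (τ'.take j)) ∧ G.Safe j (G.node (τ'.take j)) τ'[j].1 ∧
          G.Reach G.Safe (j + 1) (τ'[j].2.2, (G.node (τ'.take j)).2 + τ'[j].2.1) := by
  induction m' generalizing τ' with
  | zero =>
    rw [rollout, PMF.mem_support_pure_iff] at h'
    subst h'
    exact ⟨hτ, h, fun j hj hj' => by omega⟩
  | succ m' ih =>
    obtain ⟨σ, hσ, a, ha, o, ho, rfl⟩ := mem_rollout_succ_last.1 h'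
    obtain ⟨h1, h2, h3⟩ := ih (by omega) hσ
    have hl := (prefix_of_mem_rollout hσ).2
    rw [show m - m' = (m - (m' + 1)) + 1 by omega] at h2
    have hs := h2.safe (by omega) ha
    refine ⟨h1.append hs ho, (h2 a ha o ho).2, fun j hj hj' => ?_⟩
    rw [List.length_append, List.length_singleton] at hj
    rcases (Nat.lt_succ_iff.1 hj).eq_or_lt with rfl | hj2
    · have := h1.append hs ho
      simp only [List.length_append, List.length_singleton, node_append] at this
      simpa using ⟨h1, hs, this⟩
    · have := h3 j hj2 hj'
      rwa [List.take_append_of_le_length hj2.le, List.getElem_append_left hj2]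

theorem realizes_append {π : HPolicy (Joint G.k) G.Obs} {τ : Hist (Joint G.k) G.Obs}
    {a : Joint G.k} {o : G.Obs} :
    G.Realizes π (τ ++ [(a, o)]) ↔
      G.Realizes π τ ∧ a ∈ (π τ).support ∧ o ∈ (G.kernel τ a).support := by
  simp only [Realizes, pos_iff_ne_zero, ← PMF.mem_support_iff, List.length_append,
    List.length_singleton, mem_rollout_succ_last]
  constructor
  · rintro ⟨σ, hσ, b, hb, x, hx, h⟩
    obtain ⟨rfl, h2⟩ := List.append_inj' h rfl
    simp only [List.cons.injEq, Prod.mk.injEq, and_true] at h2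
    obtain ⟨rfl, rfl⟩ := h2
    exact ⟨hσ, hb, hx⟩
  · rintro ⟨h1, h2, h3⟩
    exact ⟨τ, h1, a, h2, o, h3, rfl⟩

theorem realizes_nil (π : HPolicy (Joint G.k) G.Obs) : G.Realizes π [] := by
  simp [Realizes, rollout]

/-- A policy that may play every action satisfying `ok` realizes all nodes reachable through such
actions. -/
theorem Reach.realizes {ok : ℕ → G.Node → Joint G.k → Prop} {π : HPolicy (Joint G.k) G.Obs}
    (hπ : ∀ τ : Hist (Joint G.k) G.Obs, G.Reach ok τ.length (G.node τ) → τ.length < G.H →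
      ∀ a, ok τ.length (G.node τ) a → a ∈ (π τ).support)
    {t : ℕ} {x : G.Node} (hx : G.Reach ok t x) (ht : t ≤ G.H) :
    ∃ τ : Hist (Joint G.k) G.Obs, τ.length = t ∧ G.Realizes π τ ∧ G.node τ = x := by
  induction hx with
  | root => exact ⟨[], rfl, realizes_nil π, rfl⟩
  | @step t x a c s h1 ha hc hs ih =>
    obtain ⟨τ, rfl, h2, rfl⟩ := ih (by omega)
    refine ⟨τ ++ [(a, (c, s))], by simp, realizes_append.2 ⟨h2, hπ τ h1 (by omega) a ha, ?_⟩,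
      G.node_append _ _ _⟩
    exact G.mem_kernel.2 ⟨hc, hs⟩

variable (G) in
theorem joint_nonempty : Nonempty (Joint G.k) := ⟨fun i => ⟨0, G.k_pos i⟩⟩

open Classical in
variable (G) in
/-- Plays all safe actions with the same probability. -/
noncomputable def safePolicy : HPolicy (Joint G.k) G.Obs := fun τ =>
  if h : ∃ a, G.Safe τ.length (G.node τ) a then
    PMF.uniformOfFinset (Finset.univ.filter fun a => G.Safe τ.length (G.node τ) a)
      (by obtain ⟨a, ha⟩ := h; exact ⟨a, by simpa using ha⟩)
  else PMF.pure fun i => ⟨0, G.k_pos i⟩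

theorem mem_safePolicy {τ : Hist (Joint G.k) G.Obs} (h : ∃ a, G.Safe τ.length (G.node τ) a)
    (a : Joint G.k) : a ∈ (G.safePolicy τ).support ↔ G.Safe τ.length (G.node τ) a := by
  classical
  rw [safePolicy, dif_pos h]
  simp

/-- Safely reachable nodes before the horizon are live, so the default action in `safePolicy` is
never used there. -/
theorem safePolicy_feasible (h0 : G.Live G.H 0 (G.s₁, 0)) : G.safePolicy ∈ G.feasiblePolicies := by
  rw [mem_feasiblePolicies]
  refine abides_of_safe (fun τ hτ h a ha => ?_) (by simp) .root
  exact (mem_safePolicy ((G.live_iff_exists_safe hτ _).1 (h.live h0)) a).1 ha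

variable (G) in
theorem feasiblePolicies_ne_empty : G.feasiblePolicies ≠ ∅ ↔ G.Live G.H 0 (G.s₁, 0) := by
  rw [← Set.nonempty_iff_ne_empty]
  constructor
  · rintro ⟨π, h⟩
    exact (mem_feasiblePolicies.1 h).live
  · exact fun h => ⟨_, safePolicy_feasible h⟩

theorem Realizes.steps {π : HPolicy (Joint G.k) G.Obs} {τ : Hist (Joint G.k) G.Obs}
    (hπ : π ∈ G.feasiblePolicies) (hτ : τ.length ≤ G.H) (h : G.Realizes π τ) :
    G.Reach G.Safe τ.length (G.node τ) ∧ G.Abides π (G.H - τ.length) τ ∧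
      ∀ j (hj : j < τ.length),
        G.Reach G.Safe j (G.node (τ.take j)) ∧ G.Safe j (G.node (τ.take j)) τ[j].1 ∧
          G.Reach G.Safe (j + 1) (τ[j].2.2, (G.node (τ.take j)).2 + τ[j].2.1) := by
  have := (mem_feasiblePolicies.1 hπ).steps (by simp) hτ .root
    ((PMF.mem_support_iff _ _).2 h.ne')
  exact ⟨this.1, this.2.1, fun j hj => this.2.2 j hj (Nat.zero_le _)⟩

/-- A feasible policy plays only safe actions along realized histories; conversely, the single
policy `safePolicy` is a witness for all nodes at once. -/
theorem mem_FS (h0 : G.Live G.H 0 (G.s₁, 0)) {t : ℕ} (ht : t ≤ G.H) (x : G.Node) :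
    x ∈ G.FS t ↔ G.Reach G.Safe t x := by
  constructor
  · rintro ⟨π, hπ, τ, rfl, h, rfl⟩
    exact (h.steps hπ ht).1
  · intro hx
    obtain ⟨τ, h1, h2, h3⟩ := hx.realizes (π := G.safePolicy) (fun τ _ _ a ha =>
      (mem_safePolicy ⟨a, ha⟩ a).2 ha) ht
    exact ⟨_, safePolicy_feasible h0, τ, h1, h2, h3⟩

theorem mem_FA (h0 : G.Live G.H 0 (G.s₁, 0)) {t : ℕ} (ht : t < G.H) (x : G.Node)
    (a : Joint G.k) : a ∈ G.FA t x ↔ G.Reach G.Safe t x ∧ G.Safe t x a := by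
  constructor
  · rintro ⟨π, hπ, τ, o, rfl, h, rfl⟩
    have h1 := realizes_append.1 h
    have h2 := h1.1.steps hπ ht.le
    refine ⟨h2.1, ?_⟩
    have h3 := h2.2.1
    rw [show G.H - τ.length = (G.H - τ.length - 1) + 1 by omega] at h3
    exact h3.safe (by omega) h1.2.1
  · rintro ⟨hx, ha⟩
    obtain ⟨τ, rfl, h2, rfl⟩ := hx.realizes (π := G.safePolicy) (fun τ _ _ a ha =>
      (mem_safePolicy ⟨a, ha⟩ a).2 ha) ht.le
    obtain ⟨o, ho⟩ := (G.kernel τ a).support_nonempty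
    exact ⟨_, safePolicy_feasible h0, τ, o, rfl,
      realizes_append.2 ⟨h2, (mem_safePolicy ⟨a, ha⟩ a).2 ha, ho⟩, rfl⟩

end ACMG

/-! ### Product distributions and relabelled histories. -/

namespace Play

/-- For NE the output must be a product at every history, including those without a row, where a
fixed joint action is played. -/
theorem isProductDist_pure {n : ℕ} {k : Fin n → ℕ} (b : Joint k) :
    IsProductDist (PMF.pure b) := by
  classical
  refine ⟨fun i => PMF.pure (b i), fun a => ?_⟩
  simp only [PMF.pure_apply]
  by_cases h : a = b
  · subst h; simp
  · obtain ⟨i, hi⟩ := Function.ne_iff.1 h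
    rw [if_neg h, eq_comm, Finset.prod_eq_zero (Finset.mem_univ i)]
    rw [if_neg hi]

/-- Transport of a policy along a bijection between two kinds of histories. -/
def transport {A X Y : Type} (e : Hist A X ≃ Hist A Y) (π : HPolicy A X) : HPolicy A Y :=
  fun τ => π (e.symm τ)

/-- A deviation acts separately at each history, so renaming the histories in the deviating map
suffices. -/
theorem transport_mem_deviations {n : ℕ} {k : Fin n → ℕ} {X Y : Type}
    (e : Hist (Joint k) X ≃ Hist (Joint k) Y) {kind : Kind} {π π' : HPolicy (Joint k) X}
    {i : Fin n} (h : π' ∈ deviations kind π i) :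
    transport e π' ∈ deviations kind (transport e π) i := by
  cases kind <;> obtain ⟨φ, rfl⟩ := h <;> exact ⟨fun τ => φ (e.symm τ), rfl⟩

end Play

/-! ### The tables of the reduced game. -/

namespace ACMG
open Play

variable (G : ACMG)

variable {G} in
/-- A reducible copy of `Tables.game`. -/
abbrev Tables.toGame (T : G.Tables) : ACGame where
  n := G.n
  k := G.k
  k_pos := G.k_pos
  H := G.H
  State := G.Node
  s₁ := (G.s₁, 0)
  states := T.states
  acts := T.acts
  trans := T.trans
  r := T.r

variable {G} in
/-- A Markovian policy on the pairs (state, cumulative cost) as a policy for `G`. -/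
noncomputable def Tables.lookup (T : G.Tables) (π : T.toGame.Policy) :
    HPolicy (Joint G.k) G.Obs :=
  fun τ => T.toGame.row π τ.length (G.node τ)

open Classical in
/-- The tables of the reduced game. -/
noncomputable def reducedTables : G.Tables where
  states := fun t => if t ≤ G.H then (G.FS_finite t).toFinset else ∅
  acts := fun t x => if t < G.H then Finset.univ.filter fun a => a ∈ G.FA t x else ∅
  trans := fun t x a =>
    if t < G.H ∧ x ∈ G.FS t ∧ a ∈ G.FA t x then
      ∑ c ∈ G.costs t x.1 a, ∑ s : Fin G.S,
        Finsupp.single (s, x.2 + c) ((G.C t x.1 a c).toReal * (G.P t x.1 a s).toReal)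
    else 0
  r := fun t x a => if t < G.H ∧ x ∈ G.FS t ∧ a ∈ G.FA t x then G.r t x.1 a else 0

variable {G}

theorem mem_reduced_states (h0 : G.Live G.H 0 (G.s₁, 0)) {t : ℕ} (ht : t ≤ G.H) (x : G.Node) :
    x ∈ G.reducedTables.states t ↔ G.Reach G.Safe t x := by
  simp [reducedTables, ht, mem_FS h0 ht]

theorem mem_reduced_acts (h0 : G.Live G.H 0 (G.s₁, 0)) {t : ℕ} (ht : t < G.H) (x : G.Node)
    (a : Joint G.k) : a ∈ G.reducedTables.acts t x ↔ G.Reach G.Safe t x ∧ G.Safe t x a := by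
  simp [reducedTables, ht, mem_FA h0 ht]

theorem reduced_r (h0 : G.Live G.H 0 (G.s₁, 0)) {t : ℕ} (ht : t < G.H) {x : G.Node}
    (hx : G.Reach G.Safe t x) {a : Joint G.k} (ha : G.Safe t x a) : G.reducedTables.r t x a = G.r t x.1 a := by
  simp [reducedTables, ht, mem_FS h0 ht.le, mem_FA h0 ht, hx, ha]

theorem reduced_trans (h0 : G.Live G.H 0 (G.s₁, 0)) {t : ℕ} (ht : t < G.H) {x : G.Node}
    (hx : G.Reach G.Safe t x) {a : Joint G.k} (ha : G.Safe t x a) :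
    G.reducedTables.trans t x a = ∑ c ∈ G.costs t x.1 a, ∑ s : Fin G.S,
      Finsupp.single (s, x.2 + c) ((G.C t x.1 a c).toReal * (G.P t x.1 a s).toReal) := by
  simp [reducedTables, ht, mem_FS h0 ht.le, mem_FA h0 ht, hx, ha]

variable (G) in
/-- The law of the next node. -/
noncomputable def nextNode (t : ℕ) (x : G.Node) (a : Joint G.k) : PMF G.Node :=
  ((G.C t x.1 a).bind fun c => (G.P t x.1 a).map fun s => (c, s)).map fun o => (o.2, x.2 + o.1)

/-- Translation by `x.2` is injective, so exactly one cost leads to `y`, and the probabilities do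
not merge. -/
theorem nextNode_apply (t : ℕ) (x : G.Node) (a : Joint G.k) (y : G.Node) :
    G.nextNode t x a y = G.C t x.1 a (y.2 - x.2) * G.P t x.1 a y.1 := by
  classical
  obtain ⟨s, d⟩ := y
  rw [nextNode, PMF.map_bind, PMF.bind_apply, tsum_eq_single (d - x.2)]
  · congr 1
    rw [PMF.map_comp, PMF.map_apply, tsum_eq_single s]
    · simp
    · intro s' hs'
      simp [Ne.symm hs']
  · intro c' hc'
    rw [PMF.map_comp, PMF.map_apply]
    have : d ≠ x.2 + c' := fun h => hc' (by simp [h])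
    simp [this]

variable (G) in
/-- A row of the transition table of the reduced game. -/
noncomputable def transTable (t : ℕ) (x : G.Node) (a : Joint G.k) : G.Node →₀ ℝ :=
  ∑ c ∈ G.costs t x.1 a, ∑ s : Fin G.S,
    Finsupp.single (s, x.2 + c) ((G.C t x.1 a c).toReal * (G.P t x.1 a s).toReal)

theorem transTable_apply (t : ℕ) (x : G.Node) (a : Joint G.k) (y : G.Node) :
    G.transTable t x a y = (G.C t x.1 a (y.2 - x.2)).toReal * (G.P t x.1 a y.1).toReal := by
  classical
  obtain ⟨s, d⟩ := y
  simp only [transTable, Finsupp.finsetSum_apply]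
  rw [Finset.sum_eq_single (d - x.2)]
  · rw [Finset.sum_eq_single s]
    · simp
    · intro s' _ hs'
      simp [hs']
    · simp
  · intro c' _ hc'
    have : x.2 + c' ≠ d := fun h => hc' (by simp [← h])
    simp [this]
  · intro hc
    rw [mem_costs, not_not] at hc
    refine Finset.sum_eq_zero fun s' _ => ?_
    by_cases hs : (s', x.2 + (d - x.2)) = (s, d)
    · simp [hc]
    · rw [Finsupp.single_apply, if_neg hs]

/-- Identifies the real table with a `PMF`; normalization of the table then needs no computation. -/
theorem ofReal_transTable (t : ℕ) (x : G.Node) (a : Joint G.k) (y : G.Node) :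
    ENNReal.ofReal (G.transTable t x a y) = G.nextNode t x a y := by
  rw [transTable_apply, nextNode_apply, ← ENNReal.toReal_mul, ENNReal.ofReal_toReal]
  exact ENNReal.mul_ne_top (PMF.apply_ne_top _ _) (PMF.apply_ne_top _ _)

theorem tsum_ofReal_transTable (t : ℕ) (x : G.Node) (a : Joint G.k) :
    ∑' y, ENNReal.ofReal (G.transTable t x a y) = 1 := by
  simp_rw [ofReal_transTable]
  exact PMF.tsum_coe _

theorem transTable_nonneg (t : ℕ) (x : G.Node) (a : Joint G.k) (y : G.Node) :
    0 ≤ G.transTable t x a y := by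
  rw [transTable_apply]; positivity

theorem transTable_support {t : ℕ} {x : G.Node} {a : Joint G.k} {y : G.Node}
    (hy : y ∈ (G.transTable t x a).support) :
    y.2 - x.2 ∈ G.costs t x.1 a ∧ G.P t x.1 a y.1 ≠ 0 := by
  rw [Finsupp.mem_support_iff, transTable_apply] at hy
  rw [mem_costs]
  constructor <;> intro h <;> simp [h] at hy

theorem transTable_sum (t : ℕ) (x : G.Node) (a : Joint G.k) :
    ((G.transTable t x a).sum fun _ p => p) = 1 := by
  have h := tsum_ofReal_transTable t x a
  rw [tsum_eq_sum (s := (G.transTable t x a).support)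
    (fun y hy => by simp [Finsupp.notMem_support_iff.1 hy]),
    ← ENNReal.ofReal_sum_of_nonneg fun y _ => transTable_nonneg t x a y] at h
  exact ENNReal.ofReal_eq_one.1 h

theorem step_of_mem_transTable {t : ℕ} {x : G.Node} {a : Joint G.k} {y : G.Node}
    (hx : G.Reach G.Safe t x) (ha : G.Safe t x a) (hy : y ∈ (G.transTable t x a).support) :
    G.Reach G.Safe (t + 1) y := by
  obtain ⟨h1, h2⟩ := transTable_support hy
  have := Reach.step hx ha h1 h2
  rwa [add_sub_cancel] at this

theorem reduced_wellFormed (h0 : G.Live G.H 0 (G.s₁, 0)) : G.reducedTables.toGame.WellFormed := by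
  refine ⟨(mem_reduced_states h0 (Nat.zero_le _) _).2 .root, fun t ht x hx a ha => ?_⟩
  obtain ⟨hx, ha⟩ := (mem_reduced_acts h0 ht x a).1 ha
  have h : G.reducedTables.toGame.trans t x a = G.transTable t x a := reduced_trans h0 ht hx ha
  rw [h]
  exact ⟨transTable_nonneg t x a, transTable_sum t x a, fun y hy =>
    (mem_reduced_states h0 (Nat.succ_le_of_lt ht) y).2 (step_of_mem_transTable hx ha hy)⟩

/-- Every state before the horizon is live and hence has a safe action; choosing one at each state
gives a deterministic feasible policy. -/
theorem reduced_feasible (h0 : G.Live G.H 0 (G.s₁, 0)) : G.reducedTables.toGame.Feasible := by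
  have : ∀ (t : Fin G.H) (x : {x // x ∈ G.reducedTables.states t}),
      ∃ a, a ∈ G.reducedTables.acts t x.1 := by
    intro t x
    have hx := (mem_reduced_states h0 t.2.le _).1 x.2
    obtain ⟨a, ha⟩ := (G.live_iff_exists_safe t.2 _).1 (hx.live h0)
    exact ⟨a, (mem_reduced_acts h0 t.2 _ _).2 ⟨hx, ha⟩⟩
  choose f hf using this
  refine ⟨fun t x => PMF.pure (f t x), fun t x a ha => ?_⟩
  rw [PMF.mem_support_pure_iff] at ha
  subst ha
  exact hf t x

/-! ### Histories of the reduced game -/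

/-- Replace the observed costs by cumulative ones, starting from `c₀`. -/
def accumulate : (Fin G.n → ℝ) → Hist (Joint G.k) G.Obs → Hist (Joint G.k) G.Node
  | _, [] => []
  | c₀, (a, o) :: τ => (a, (o.2, c₀ + o.1)) :: accumulate (c₀ + o.1) τ

/-- Recover the observed costs from the cumulative ones. -/
def decumulate : (Fin G.n → ℝ) → Hist (Joint G.k) G.Node → Hist (Joint G.k) G.Obs
  | _, [] => []
  | c₀, (a, x) :: τ => (a, (x.2 - c₀, x.1)) :: decumulate x.2 τ

variable (G) in
/-- Histories of `G` correspond to histories on the pairs (state, cumulative cost). -/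
def histEquiv : Hist (Joint G.k) G.Obs ≃ Hist (Joint G.k) G.Node where
  toFun := accumulate 0
  invFun := decumulate 0
  left_inv τ := by
    -- The recursion changes the initial cost, so the induction must run over all of them.
    generalize (0 : Fin G.n → ℝ) = c₀
    induction τ generalizing c₀ with
    | nil => rfl
    | cons p τ ih => simp [accumulate, decumulate, ih]
  right_inv τ := by
    generalize (0 : Fin G.n → ℝ) = c₀
    induction τ generalizing c₀ with
    | nil => rfl
    | cons p τ ih => simp [accumulate, decumulate, ih]

@[simp] theorem histEquiv_nil : G.histEquiv [] = [] := rfl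

theorem histEquiv_append (τ : Hist (Joint G.k) G.Obs) (a : Joint G.k) (o : G.Obs) :
    G.histEquiv (τ ++ [(a, o)]) = G.histEquiv τ ++ [(a, (o.2, G.cum τ + o.1))] := by
  have h : ∀ c₀ : Fin G.n → ℝ, accumulate c₀ (τ ++ [(a, o)]) =
      accumulate c₀ τ ++ [(a, (o.2, c₀ + G.cum τ + o.1))] := by
    induction τ with
    | nil => intro c₀; simp [accumulate]
    | cons p τ ih => intro c₀; simp [accumulate, ih, cum, add_assoc]
  have := h 0
  rw [zero_add] at this
  exact this

@[simp] theorem histEquiv_length (τ : Hist (Joint G.k) G.Obs) :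
    (G.histEquiv τ).length = τ.length := by
  induction τ using List.reverseRecOn with
  | nil => rfl
  | append_singleton τ p ih => obtain ⟨a, o⟩ := p; simp [histEquiv_append, ih]

theorem histEquiv_take (τ : Hist (Joint G.k) G.Obs) (j : ℕ) :
    (G.histEquiv τ).take j = G.histEquiv (τ.take j) := by
  induction τ using List.reverseRecOn with
  | nil => simp
  | append_singleton τ p ih =>
    obtain ⟨a, o⟩ := p
    rcases le_or_gt j τ.length with hj | hj
    · rw [histEquiv_append, List.take_append_of_le_length (by simpa using hj), ih,
        List.take_append_of_le_length hj]
    · rw [List.take_of_length_le (by simp; omega), List.take_of_length_le (by simp; omega)]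

theorem histEquiv_getElem (τ : Hist (Joint G.k) G.Obs) (j : ℕ) (hj : j < (G.histEquiv τ).length)
    (hj' : j < τ.length) :
    (G.histEquiv τ)[j] = (τ[j].1, (τ[j].2.2, G.cum (τ.take j) + τ[j].2.1)) := by
  induction τ using List.reverseRecOn with
  | nil => simp at hj'
  | append_singleton τ p ih =>
    obtain ⟨a, o⟩ := p
    rw [List.length_append, List.length_singleton] at hj'
    simp only [histEquiv_append]
    rcases (Nat.lt_succ_iff.1 hj').eq_or_lt with rfl | h
    · simp
    · rw [List.getElem_append_left (by simpa using h), ih (by simpa using h) h,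
        List.take_append_of_le_length h.le, List.getElem_append_left h]

/-! ### Transport of laws, values and equilibria. -/

theorem game_cur (T : G.Tables) (τ : Hist (Joint G.k) G.Obs) :
    T.toGame.cur (G.histEquiv τ) = G.node τ := by
  induction τ using List.reverseRecOn with
  | nil => rfl
  | append_singleton τ p ih =>
    obtain ⟨a, o⟩ := p
    rw [histEquiv_append, node_append]
    simp [ACGame.cur, node]

/-- The output policy is the transported policy of the reduced game. -/
theorem transport_lookup (T : G.Tables) (π : T.toGame.Policy) :
    transport G.histEquiv (T.lookup π) = T.toGame.toHPolicy π := by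
  funext τ
  obtain ⟨σ, rfl⟩ := G.histEquiv.surjective τ
  simp only [transport, Equiv.symm_apply_apply, Tables.lookup, ACGame.toHPolicy, game_cur]
  rw [histEquiv_length]

/-- Reachability and safety are essential: elsewhere the table is empty and the reduced kernel takes
its default value. -/
theorem reduced_kernel (h0 : G.Live G.H 0 (G.s₁, 0)) {τ : Hist (Joint G.k) G.Obs}
    (hτ : τ.length < G.H) (hx : G.Reach G.Safe τ.length (G.node τ)) {a : Joint G.k}
    (ha : G.Safe τ.length (G.node τ) a) :
    G.reducedTables.toGame.kernel (G.histEquiv τ) a =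
      (G.kernel τ a).map fun o => (o.2, G.cum τ + o.1) := by
  have h : G.reducedTables.toGame.trans (G.histEquiv τ).length
      (G.reducedTables.toGame.cur (G.histEquiv τ)) a = G.transTable τ.length (G.node τ) a := by
    rw [game_cur, histEquiv_length]; exact reduced_trans h0 hτ hx ha
  have h1 : ∑' y, ENNReal.ofReal (G.reducedTables.toGame.trans (G.histEquiv τ).length
      (G.reducedTables.toGame.cur (G.histEquiv τ)) a y) = 1 := by
    rw [h]; exact tsum_ofReal_transTable _ _ _
  refine (show G.reducedTables.toGame.kernel (G.histEquiv τ) a = _ from dif_pos h1).trans ?_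
  change _ = G.nextNode τ.length (G.node τ) a
  refine PMF.ext fun y => ?_
  rw [← ofReal_transTable, ← h]
  rfl

/-- A policy that keeps the budgets stays where the kernels agree, and it keeps the budgets after
every realized round, so the induction continues. Since `π` is arbitrary otherwise, this covers
deviations too. -/
theorem rollout_transport (h0 : G.Live G.H 0 (G.s₁, 0)) {π : HPolicy (Joint G.k) G.Obs} {m : ℕ}
    {τ : Hist (Joint G.k) G.Obs} (hm : τ.length + m = G.H)
    (hx : G.Reach G.Safe τ.length (G.node τ)) (hπ : G.Abides π m τ) :
    rollout G.reducedTables.toGame.kernel (transport G.histEquiv π) m (G.histEquiv τ) =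
      (rollout G.kernel π m τ).map G.histEquiv := by
  induction m generalizing τ with
  | zero => exact (PMF.pure_map _ _).symm
  | succ m ih =>
    change (transport G.histEquiv π (G.histEquiv τ)).bind _ = PMF.map _ (PMF.bind _ _)
    rw [PMF.map_bind]
    simp only [transport, Equiv.symm_apply_apply]
    refine bind_congr_support _ fun a ha => ?_
    have hs := hπ.safe hm ha
    rw [reduced_kernel h0 (by omega) hx hs, PMF.map_bind, PMF.bind_map]
    refine bind_congr_support _ fun o ho => ?_
    rw [← ih (by simp; omega) (hx.append hs ho) (hπ a ha o ho).2, histEquiv_append]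
    rfl

theorem Abides.gain_eq (h0 : G.Live G.H 0 (G.s₁, 0)) {π : HPolicy (Joint G.k) G.Obs} {m : ℕ}
    {τ τ' : Hist (Joint G.k) G.Obs} (hm : τ.length + m = G.H)
    (hx : G.Reach G.Safe τ.length (G.node τ)) (hπ : G.Abides π m τ)
    (h' : τ' ∈ (rollout G.kernel π m τ).support) (i : Fin G.n) :
    gain (fun σ a => G.reducedTables.toGame.r σ.length (G.reducedTables.toGame.cur σ) a i) τ.length
      (G.histEquiv τ') = gain (fun σ a => G.r σ.length (G.cur σ) a i) τ.length τ' := by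
  have hl := (prefix_of_mem_rollout h').2
  refine Fintype.sum_equiv (finCongr (histEquiv_length τ')) _ _ fun j => ?_
  simp only [finCongr_apply, Fin.val_cast]
  by_cases hj : τ.length ≤ (j : ℕ)
  · have hj' : (j : ℕ) < τ'.length := by simpa using j.2
    obtain ⟨h1, h2, -⟩ := (hπ.steps hm le_rfl hx h').2.2 j hj' hj
    rw [if_pos hj, if_pos hj]
    simp only [List.get_eq_getElem, Fin.val_cast]
    rw [histEquiv_getElem τ' j j.2 hj', histEquiv_take, game_cur, histEquiv_length,
      List.length_take, min_eq_left hj'.le]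
    exact congrFun (reduced_r h0 (by omega) h1 h2) i
  · rw [if_neg hj, if_neg hj]

/-- Reindexing along `histEquiv` matches the two sums term by term: rewards agree on the support of
the law, and outside it the weight is zero. -/
theorem Abides.value_eq (h0 : G.Live G.H 0 (G.s₁, 0)) {π : HPolicy (Joint G.k) G.Obs}
    {τ : Hist (Joint G.k) G.Obs} (hτ : τ.length ≤ G.H)
    (hx : G.Reach G.Safe τ.length (G.node τ)) (hπ : G.Abides π (G.H - τ.length) τ)
    (i : Fin G.n) :
    G.reducedTables.toGame.value i (transport G.histEquiv π) (G.histEquiv τ) = G.value i π τ := by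
  have hm : τ.length + (G.H - τ.length) = G.H := by omega
  simp only [ACGame.value, ACMG.value, Play.value]
  refine (G.histEquiv.tsum_eq _).symm.trans (tsum_congr fun τ' => ?_)
  rw [histEquiv_length]
  change (rollout G.reducedTables.toGame.kernel (transport G.histEquiv π) (G.H - τ.length)
    (G.histEquiv τ) (G.histEquiv τ')).toReal * _ = _
  rw [rollout_transport h0 hm hx hπ]
  have hmap : (rollout G.kernel π (G.H - τ.length) τ).map G.histEquiv (G.histEquiv τ') =
      rollout G.kernel π (G.H - τ.length) τ τ' := by
    classical
    rw [PMF.map_apply, tsum_eq_single τ']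
    · simp
    · intro σ hσ
      simp [Ne.symm hσ]
  rw [hmap]
  by_cases h' : τ' ∈ (rollout G.kernel π (G.H - τ.length) τ).support
  · rw [hπ.gain_eq h0 hm hx h' i]
  · rw [PMF.mem_support_iff, not_not] at h'
    simp [h']

/-- Ensures that every deviation admitted in the definition of an ACSPE competes in the equilibrium
condition of the reduced game. The converse is not needed. -/
theorem Abides.subgameFeasible (h0 : G.Live G.H 0 (G.s₁, 0)) {π : HPolicy (Joint G.k) G.Obs}
    {τ : Hist (Joint G.k) G.Obs} (hτ : τ.length ≤ G.H)
    (hx : G.Reach G.Safe τ.length (G.node τ)) (hπ : G.Abides π (G.H - τ.length) τ) :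
    G.reducedTables.toGame.SubgameFeasible (transport G.histEquiv π) (G.histEquiv τ) := by
  have hm : τ.length + (G.H - τ.length) = G.H := by omega
  rw [ACGame.SubgameFeasible, histEquiv_length]
  change (rollout G.reducedTables.toGame.kernel (transport G.histEquiv π) (G.H - τ.length)
    (G.histEquiv τ)).toOuterMeasure _ = 1
  rw [rollout_transport h0 hm hx hπ, PMF.toOuterMeasure_apply_eq_one_iff, PMF.support_map]
  rintro _ ⟨τ', h', rfl⟩ j hj
  have hl := (prefix_of_mem_rollout h').2
  have hj' : (j : ℕ) < τ'.length := by simpa using j.2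
  obtain ⟨h1, h2, -⟩ := (hπ.steps hm le_rfl hx h').2.2 j hj' hj
  simp only [List.get_eq_getElem]
  rw [histEquiv_getElem τ' j j.2 hj', histEquiv_take, game_cur]
  exact (mem_reduced_acts h0 (by omega) _ _).2 ⟨h1, h2⟩

theorem FeasiblyRealizable.isHistory (h0 : G.Live G.H 0 (G.s₁, 0))
    {τ : Hist (Joint G.k) G.Obs} (hτ : G.FeasiblyRealizable τ) :
    G.reducedTables.toGame.IsHistory (G.histEquiv τ) := by
  obtain ⟨hl, π, hπ, h⟩ := hτ
  refine ⟨by rw [histEquiv_length]; exact hl, fun j => ?_⟩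
  have hj' : (j : ℕ) < τ.length := by simpa using j.2
  obtain ⟨h1, h2, h3⟩ := (h.steps hπ hl).2.2 j hj'
  simp only [List.get_eq_getElem]
  rw [histEquiv_getElem τ j j.2 hj', histEquiv_take, game_cur]
  exact ⟨(mem_reduced_acts h0 (by omega) _ _).2 ⟨h1, h2⟩,
    (mem_reduced_states h0 (by omega) _).2 h3⟩

theorem FeasiblyRealizable.reach {τ : Hist (Joint G.k) G.Obs} (hτ : G.FeasiblyRealizable τ) :
    G.Reach G.Safe τ.length (G.node τ) := by
  obtain ⟨hl, π, hπ, h⟩ := hτ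
  exact (h.steps hπ hl).1

/-- The past imposes no further condition: its rounds used safe actions, and the observed costs lie
in the supports for which safety guarantees the budgets. -/
theorem FeasiblyRealizable.mem_subgamePolicies_iff {τ : Hist (Joint G.k) G.Obs}
    (hτ : G.FeasiblyRealizable τ) {π : HPolicy (Joint G.k) G.Obs} :
    π ∈ G.subgamePolicies τ ↔ G.Abides π (G.H - τ.length) τ := by
  rw [mem_subgamePolicies hτ.1, and_iff_right]
  obtain ⟨hl, π, hπ, h⟩ := hτ
  intro j hj1 hj2
  obtain ⟨j, rfl⟩ := Nat.exists_eq_add_of_le' hj1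
  obtain ⟨-, h3, -⟩ := (h.steps hπ hl).2.2 j (by omega)
  have h4 : τ.take (j + 1) = τ.take j ++ [(τ[j].1, τ[j].2)] := by
    simp
  have h5 : G.Realizes π (τ.take (j + 1)) := by
    -- Prefixes of realized histories are realized; this puts the cost observed in round `j` into
    -- the support of the cost distribution.
    have key : ∀ σ : Hist (Joint G.k) G.Obs, G.Realizes π σ → ∀ i, G.Realizes π (σ.take i) := by
      intro σ
      induction σ using List.reverseRecOn with
      | nil => intro h i; simpa using h
      | append_singleton σ p ih =>
        obtain ⟨a, o⟩ := p
        intro h i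
        rcases le_or_gt i σ.length with hi | hi
        · rw [List.take_append_of_le_length hi]
          exact ih (realizes_append.1 h).1 i
        · rwa [List.take_of_length_le (by simp; omega)]
    exact key τ h _
  rw [h4] at h5 ⊢
  rw [cum_append]
  have h6 := G.mem_kernel.1 (realizes_append.1 h5).2.2
  rw [List.length_take, min_eq_left (by omega)] at h6
  exact (h3 _ h6.1).1

/-- A Markov-perfect equilibrium of the reduced game is an equilibrium of `G`. -/
theorem isACSPE_of_isMPE (h0 : G.Live G.H 0 (G.s₁, 0)) {kind : Kind}
    {π : G.reducedTables.toGame.Policy} (hπ : G.reducedTables.toGame.IsMPE kind π) :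
    G.IsACSPE kind (G.reducedTables.lookup π) := by
  have hab : ∀ τ, G.FeasiblyRealizable τ →
      G.Abides (G.reducedTables.lookup π) (G.H - τ.length) τ := by
    intro τ hτ
    have hl := hτ.1
    refine abides_of_safe (fun σ hσ hx a ha => ?_) (by omega) hτ.reach
    -- A safely reachable node is a state of the reduced game, so the lookup finds a row and
    -- feasibility of `π` applies, not the default action.
    have hmem := (mem_reduced_states h0 hσ.le _).2 hx
    have h1 : σ.length < G.reducedTables.toGame.H ∧
      G.node σ ∈ G.reducedTables.toGame.states σ.length := ⟨hσ, hmem⟩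
    simp only [Tables.lookup, ACGame.row] at ha
    rw [dif_pos h1] at ha
    exact ((mem_reduced_acts h0 hσ _ _).1 (hπ.feasible ⟨σ.length, hσ⟩ ⟨_, hmem⟩ ha)).2
  refine ⟨fun τ hτ => hτ.mem_subgamePolicies_iff.2 (hab τ hτ), ?_, ?_⟩
  · intro τ hτ i π' hdev hf
    have hf' := hτ.mem_subgamePolicies_iff.1 hf
    rw [← hf'.value_eq h0 hτ.1 hτ.reach i, ← (hab τ hτ).value_eq h0 hτ.1 hτ.reach i]
    have hdev' := transport_mem_deviations G.histEquiv hdev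
    rw [transport_lookup] at hdev' ⊢
    exact hπ.stable i _ (hτ.isHistory h0) _ hdev' (hf'.subgameFeasible h0 hτ.1 hτ.reach)
  · intro hk τ
    simp only [Tables.lookup, ACGame.row]
    split_ifs with h
    · exact hπ.product hk _ _
    · exact isProductDist_pure _

end ACMG

/-! ### Values computed by loops. -/

namespace Timed

variable {α β : Type}

@[simp] theorem bind_val (m : Timed α) (f : α → Timed β) : (m >>= f).val = (f m.val).val := rfl

@[simp] theorem bind_time (m : Timed α) (f : α → Timed β) :
    (m >>= f).time = m.time + (f m.val).time := rfl

@[simp] theorem pure_val (a : α) : (pure a : Timed α).val = a := rfl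

@[simp] theorem pure_time (a : α) : (pure a : Timed α).time = 0 := rfl

@[simp] theorem tick_time (m : ℕ) : (tick m).time = m := rfl

theorem fold_cons (f : β → α → Timed β) (b : β) (a : α) (l : List α) :
    fold f b (a :: l) = (do tick 1; let b' ← f b a; fold f b' l) := rfl

@[simp] theorem fold_cons_val (f : β → α → Timed β) (b : β) (a : α) (l : List α) :
    (fold f b (a :: l)).val = (fold f (f b a).val l).val := rfl

@[simp] theorem fold_nil_val (f : β → α → Timed β) (b : β) : (fold f b []).val = b := rfl

/-- Describes accumulating loops by membership only, so order and repetitions play no role in the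
correctness proof. -/
theorem mem_fold {γ : Type} {f : List γ → α → Timed (List γ)} {Q : α → γ → Prop} {l : List α}
    (hf : ∀ b, ∀ a ∈ l, ∀ y, y ∈ (f b a).val ↔ y ∈ b ∨ Q a y) (b : List γ) (y : γ) :
    y ∈ (fold f b l).val ↔ y ∈ b ∨ ∃ a ∈ l, Q a y := by
  induction l generalizing b with
  | nil => simp
  | cons a l ih =>
    rw [fold_cons_val, ih (fun b a' ha' => hf b a' (List.mem_cons_of_mem _ ha')),
      hf b a List.mem_cons_self]
    simp [or_assoc]

theorem fold_val_add {M : Type} [AddCommMonoid M] {f : M → α → Timed M} {g : α → M}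
    (hf : ∀ b a, (f b a).val = b + g a) (b : M) (l : List α) :
    (fold f b l).val = b + (l.map g).sum := by
  induction l generalizing b with
  | nil => simp
  | cons a l ih => rw [fold_cons_val, ih, hf]; simp [add_assoc]

theorem all_val (p : α → Timed Bool) (l : List α) :
    (all p l).val = true ↔ ∀ a ∈ l, (p a).val = true := by
  have h : ∀ b : Bool, (fold (fun b a => do let c ← p a; pure (b && c)) b l).val = true ↔
      b = true ∧ ∀ a ∈ l, (p a).val = true := by
    induction l with
    | nil => simp
    | cons a l ih => intro b; rw [fold_cons_val, ih]; simp [and_assoc]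
  exact (h true).trans (by simp)

theorem any_val (p : α → Timed Bool) (l : List α) :
    (any p l).val = true ↔ ∃ a ∈ l, (p a).val = true := by
  have h : ∀ b : Bool, (fold (fun b a => do let c ← p a; pure (b || c)) b l).val = true ↔
      b = true ∨ ∃ a ∈ l, (p a).val = true := by
    induction l with
    | nil => simp
    | cons a l ih => intro b; rw [fold_cons_val, ih]; simp [or_assoc]
  exact (h false).trans (by simp)

@[simp] theorem filter_val (p : α → Timed Bool) (l : List α) :
    (filter p l).val = l.filter fun a => (p a).val := by
  induction l with
  | nil => rfl
  | cons a l ih => simp only [filter, bind_val, pure_val, ih, List.filter_cons]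

theorem tabulate_val [DecidableEq α] (d : β) (f : α → Timed β) (l : List α) (a : α) :
    (tabulate d f l).val a = if a ∈ l then (f a).val else d := by
  induction l with
  | nil => rfl
  | cons b l ih =>
    simp only [tabulate, bind_val, pure_val, Function.update_apply, ih, List.mem_cons]
    by_cases h : a = b
    · simp [h]
    · simp [h]

end Timed

/-! ### Correctness of the feasibility computation. -/

namespace ACMG

variable {G : ACMG} (ω : CostModel)

theorem memList_val (x : G.Node) (L : List G.Node) :
    (memList ω x L).val = true ↔ x ∈ L := by
  rw [memList, Timed.any_val]
  simp [sameNode]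

theorem mem_insertList (L : List G.Node) (x y : G.Node) :
    y ∈ (insertList ω L x).val ↔ y ∈ L ∨ y = x := by
  rw [insertList, Timed.bind_val]
  split_ifs with h
  · rw [memList_val] at h
    simp only [Timed.pure_val]
    exact ⟨Or.inl, fun h' => h'.elim id fun e => e ▸ h⟩
  · simp [or_comm]

@[simp] theorem mem_jointList (a : Joint G.k) : a ∈ G.jointList := by simp [jointList]

@[simp] theorem mem_stateList (s : Fin G.S) : s ∈ G.stateList := by simp [stateList]

theorem feasibleAction_val (t : ℕ) (x : G.Node) (a : Joint G.k) :
    (G.feasibleAction ω t x a).val = true ↔ G.Affordable t x a := by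
  rw [feasibleAction, Timed.all_val]
  simp [addCost, withinBudget, Affordable]

/-- Finiteness excludes the value `⊤`, which `toReal` sends to zero. -/
theorem isPositive_val (p : ENNReal) (hp : p ≠ ⊤) :
    (isPositive ω p.toReal).val = true ↔ p ≠ 0 := by
  simp [isPositive, ENNReal.toReal_pos_iff, pos_iff_ne_zero, hp.lt_top]

theorem mem_children (t : ℕ) (x : G.Node) (a : Joint G.k) (y : G.Node) :
    y ∈ (G.children ω t x a).val ↔
      ∃ c ∈ G.costs t x.1 a, ∃ s, G.P t x.1 a s ≠ 0 ∧ y = (s, x.2 + c) := by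
  rw [children, Timed.mem_fold (Q := fun c y => ∃ s, G.P t x.1 a s ≠ 0 ∧ y = (s, x.2 + c))]
  · simp
  · intro b c _ y
    rw [Timed.bind_val, Timed.mem_fold (Q := fun s y => G.P t x.1 a s ≠ 0 ∧ y = (s, x.2 + c))]
    · simp
    · intro b s _ y
      rw [Timed.bind_val]
      split_ifs with h
      · rw [isPositive_val ω _ (PMF.apply_ne_top _ _)] at h
        simp [h, addCost, or_comm]
      · rw [isPositive_val ω _ (PMF.apply_ne_top _ _)] at h
        simp [h]

theorem mem_expand (t : ℕ) (ok : G.Node → Joint G.k → Timed Bool) (L : List G.Node)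
    (y : G.Node) :
    y ∈ (G.expand ω t ok L).val ↔
      ∃ x ∈ L, ∃ a, (ok x a).val = true ∧ y ∈ (G.children ω t x a).val := by
  rw [expand, Timed.mem_fold
    (Q := fun x y => ∃ a, (ok x a).val = true ∧ y ∈ (G.children ω t x a).val)]
  · simp
  · intro b x _ y
    rw [Timed.mem_fold (Q := fun a y => (ok x a).val = true ∧ y ∈ (G.children ω t x a).val)]
    · simp
    · intro b a _ y
      rw [Timed.bind_val]
      split_ifs with h
      · rw [Timed.bind_val, Timed.mem_fold (Q := fun z y => y = z)]
        · simp [h]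
        · intro b z _ y
          exact mem_insertList ω b z y
      · simp [h]

/-- The common step of the forward pass (`ok` is `Affordable`) and of pruning (`ok` is `Safe`). The
test need only be correct at reached nodes, which is all that is known of `trueAction`. -/
theorem mem_expand_reach {ok : ℕ → G.Node → Joint G.k → Prop} {t : ℕ}
    {f : G.Node → Joint G.k → Timed Bool} {L : List G.Node}
    (hL : ∀ x, x ∈ L ↔ G.Reach ok t x)
    (hf : ∀ x a, G.Reach ok t x → ((f x a).val = true ↔ ok t x a)) (y : G.Node) :
    y ∈ (G.expand ω t f L).val ↔ G.Reach ok (t + 1) y := by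
  rw [mem_expand]
  constructor
  · rintro ⟨x, hx, a, ha, hy⟩
    obtain ⟨c, hc, s, hs, rfl⟩ := (mem_children ω t x a y).1 hy
    have hx := (hL x).1 hx
    exact .step hx ((hf x a hx).1 ha) hc hs
  · intro hy
    cases hy with
    | step hx ha hc hs =>
      exact ⟨_, (hL _).2 hx, _, (hf _ _ hx).2 ha, (mem_children ω t _ _ _).2 ⟨_, hc, _, hs, rfl⟩⟩

theorem forward_val_length (m t : ℕ) (L : List G.Node) :
    (G.forward ω m t L).val.length = m + 1 := by
  induction m generalizing t L with
  | zero => rfl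
  | succ m ih => simp [forward, ih]

theorem mem_forward {m t : ℕ} {L : List G.Node} (hL : ∀ x, x ∈ L ↔ G.Reach G.Affordable t x)
    {j : ℕ} (hj : j ≤ m) (y : G.Node) :
    y ∈ (G.forward ω m t L).val.getD j [] ↔ G.Reach G.Affordable (t + j) y := by
  induction m generalizing t L j with
  | zero =>
    obtain rfl : j = 0 := by omega
    exact hL y
  | succ m ih =>
    cases j with
    | zero => exact hL y
    | succ j =>
      have := ih (mem_expand_reach ω hL fun x a _ => feasibleAction_val ω t x a)
        (j := j) (by omega)
      rw [show t + (j + 1) = t + 1 + j by omega, ← this]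
      rfl

/-- `T` contains only live nodes of the graph. Children of a graph node under an affordable action
are in the graph, so for them membership in `T` means liveness. -/
theorem trueAction_val {t : ℕ} {T : List G.Node}
    (hT : ∀ y, y ∈ T ↔ G.Reach G.Affordable (t + 1) y ∧ G.Live (G.H - (t + 1)) (t + 1) y)
    {x : G.Node} (hx : G.Reach G.Affordable t x) (a : Joint G.k) :
    (G.trueAction ω t T x a).val = true ↔ G.Safe t x a := by
  rw [trueAction, Timed.bind_val]
  split_ifs with h
  · rw [feasibleAction_val] at h
    rw [Timed.bind_val, Timed.all_val]
    simp only [memList_val, mem_children, hT]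
    constructor
    · intro h1 c hc
      exact ⟨h c hc, fun s hs => (h1 _ ⟨c, hc, s, hs, rfl⟩).2⟩
    · rintro h1 _ ⟨c, hc, s, hs, rfl⟩
      exact ⟨.step hx h hc hs, (h1 c hc).2 s hs⟩
  · rw [feasibleAction_val] at h
    refine iff_of_false (by simp) ?_
    exact fun h1 => h h1.affordable

theorem evaluate_cons (t : ℕ) (L L' : List G.Node) (Ls : List (List G.Node)) :
    G.evaluate ω t (L :: L' :: Ls) = (do
      let Ts ← G.evaluate ω (t + 1) (L' :: Ls)
      let T ← Timed.filter (fun x =>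
        Timed.any (fun a => G.trueAction ω t (Ts.headD []) x a) G.jointList) L
      pure (T :: Ts)) := rfl

theorem evaluate_val_length (t : ℕ) (Ls : List (List G.Node)) :
    (G.evaluate ω t Ls).val.length = Ls.length := by
  induction Ls generalizing t with
  | nil => rfl
  | cons L Ls ih =>
    cases Ls with
    | nil => rfl
    | cons L' Ls => exact congrArg (· + 1) (ih (t + 1))

/-- Backward induction: once the next layer is correct, `trueAction` recognizes safe actions, and a
node is live exactly if it has one. -/
theorem mem_evaluate {m t : ℕ} (hm : t + m = G.H) {Ls : List (List G.Node)}
    (hl : Ls.length = m + 1)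
    (hL : ∀ j ≤ m, ∀ x, x ∈ Ls.getD j [] ↔ G.Reach G.Affordable (t + j) x)
    {j : ℕ} (hj : j ≤ m) (y : G.Node) :
    y ∈ (G.evaluate ω t Ls).val.getD j [] ↔
      G.Reach G.Affordable (t + j) y ∧ G.Live (G.H - (t + j)) (t + j) y := by
  induction m generalizing t Ls j y with
  | zero =>
    obtain ⟨L, rfl⟩ := List.length_eq_one_iff.1 hl
    obtain rfl : j = 0 := by omega
    -- The last layer is at the horizon, where no rounds remain and every node is live.
    rw [show G.H - (t + 0) = 0 by omega]
    simpa [evaluate, Live] using hL 0 le_rfl y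
  | succ m ih =>
    obtain ⟨L, Ls, rfl⟩ : ∃ L Ls', Ls = L :: Ls' := List.exists_cons_of_length_eq_add_one hl
    have hl' : Ls.length = m + 1 := by simpa using hl
    obtain ⟨L', Ls, rfl⟩ : ∃ L Ls', Ls = L :: Ls' := List.exists_cons_of_length_eq_add_one hl'
    have ih := fun j hj y => ih (t := t + 1) (by omega) hl' (fun j hj x => by
      rw [show t + 1 + j = t + (j + 1) by omega, ← hL (j + 1) (by omega) x]; rfl) (j := j) hj y
    cases j with
    | succ j =>
      have := ih j (by omega) y
      rw [show t + 1 + j = t + (j + 1) by omega] at this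
      rw [← this]; rfl
    | zero =>
      have h1 := ih 0 (by omega)
      have hhead : (G.evaluate ω (t + 1) (L' :: Ls)).val.headD [] =
          (G.evaluate ω (t + 1) (L' :: Ls)).val.getD 0 [] := by
        cases (G.evaluate ω (t + 1) (L' :: Ls)).val <;> rfl
      have h2 := hL 0 (Nat.zero_le _) y
      simp only [List.getD_cons_zero, add_zero] at h2 ⊢
      simp only [evaluate_cons, Timed.bind_val, Timed.pure_val, Timed.filter_val,
        List.getD_cons_zero, List.mem_filter, Timed.any_val, mem_jointList, true_and]
      rw [h2, live_iff_exists_safe G (by omega)]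
      refine and_congr_right fun hy => exists_congr fun a => ?_
      rw [hhead]
      exact trueAction_val ω h1 hy a

theorem prune_val_length (t : ℕ) (L : List G.Node) (Ts : List (List G.Node)) :
    (G.prune ω t L Ts).val.length = Ts.length + 1 := by
  induction Ts generalizing t L with
  | nil => rfl
  | cons T Ts ih => simp [prune, ih]

theorem mem_prune {m t : ℕ} {L : List G.Node} {Ts : List (List G.Node)} (hl : Ts.length = m)
    (hL : ∀ x, x ∈ L ↔ G.Reach G.Safe t x)
    (hT : ∀ j < m, ∀ y, y ∈ Ts.getD j [] ↔ G.Reach G.Affordable (t + (j + 1)) y ∧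
      G.Live (G.H - (t + (j + 1))) (t + (j + 1)) y)
    {j : ℕ} (hj : j ≤ m) (y : G.Node) :
    y ∈ (G.prune ω t L Ts).val.getD j [] ↔ G.Reach G.Safe (t + j) y := by
  induction m generalizing t L Ts j with
  | zero =>
    obtain rfl := List.length_eq_zero_iff.1 hl
    obtain rfl : j = 0 := by omega
    exact hL y
  | succ m ih =>
    obtain ⟨T, Ts, rfl⟩ : ∃ L Ls', Ts = L :: Ls' := List.exists_cons_of_length_eq_add_one hl
    cases j with
    | zero => exact hL y
    | succ j =>
      have := ih (t := t + 1) (Ts := Ts) (by simpa using hl)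
        (mem_expand_reach ω hL fun x a hx =>
          -- Nodes reached through safe actions belong to the graph, as safe actions are affordable.
          trueAction_val ω (hT 0 (by omega)) (hx.mono fun _ _ _ h => h.affordable) a)
        (fun j hj y => by
          rw [show t + 1 + (j + 1) = t + (j + 1 + 1) by omega, ← hT (j + 1) (by omega)]; rfl)
        (j := j) (by omega)
      rw [show t + (j + 1) = t + 1 + j by omega, ← this]
      rfl

theorem reach_zero {ok : ℕ → G.Node → Joint G.k → Prop} {x : G.Node} :
    G.Reach ok 0 x ↔ x = (G.s₁, 0) := by
  constructor
  · intro h; cases h; rfl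
  · rintro rfl; exact .root

/-- The layers of the AND/OR graph. -/
noncomputable def layers (G : ACMG) (ω : CostModel) : List (List G.Node) :=
  (G.forward ω G.H 0 [(G.s₁, 0)]).val

/-- The TRUE nodes of the layers. -/
noncomputable def trueLayers (G : ACMG) (ω : CostModel) : List (List G.Node) :=
  (G.evaluate ω 0 (G.layers ω)).val

/-- The TRUE nodes connected to the root. -/
noncomputable def prunedLayers (G : ACMG) (ω : CostModel) : List (List G.Node) :=
  (G.prune ω 0 [(G.s₁, 0)] (G.trueLayers ω).tail).val

theorem mem_layers {j : ℕ} (hj : j ≤ G.H) (y : G.Node) :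
    y ∈ (G.layers ω).getD j [] ↔ G.Reach G.Affordable j y := by
  rw [layers, mem_forward ω (fun x => by simp [reach_zero]) hj, zero_add]

theorem layers_length : (G.layers ω).length = G.H + 1 := forward_val_length ω _ _ _

theorem trueLayers_length : (G.trueLayers ω).length = G.H + 1 := by
  rw [trueLayers, evaluate_val_length, layers_length]

theorem mem_trueLayers {j : ℕ} (hj : j ≤ G.H) (y : G.Node) :
    y ∈ (G.trueLayers ω).getD j [] ↔ G.Reach G.Affordable j y ∧ G.Live (G.H - j) j y := by
  have := mem_evaluate ω (G := G) (zero_add G.H) (layers_length ω)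
    (fun j hj x => by rw [zero_add, mem_layers ω hj]) hj y
  rwa [zero_add] at this

theorem prunedLayers_length : (G.prunedLayers ω).length = G.H + 1 := by
  rw [prunedLayers, prune_val_length, List.length_tail, trueLayers_length]; omega

theorem tail_getD {α : Type} (l : List α) (j : ℕ) (d : α) : l.tail.getD j d = l.getD (j + 1) d := by
  cases l <;> rfl

theorem mem_prunedLayers {j : ℕ} (hj : j ≤ G.H) (y : G.Node) :
    y ∈ (G.prunedLayers ω).getD j [] ↔ G.Reach G.Safe j y := by
  rw [prunedLayers, mem_prune ω (m := G.H) (t := 0)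
    (by rw [List.length_tail, trueLayers_length]; omega) (fun x => by simp [reach_zero]) ?_ hj,
    zero_add]
  intro j hj y
  rw [tail_getD, mem_trueLayers ω (Nat.succ_le_of_lt hj), zero_add]

variable (G) in
/-- The table of the feasible actions. -/
noncomputable def actionTable : Timed (ℕ → G.Node → List (Joint G.k)) :=
  Timed.tabulate (fun _ => []) (fun t =>
    Timed.tabulate [] (fun x =>
      Timed.filter (G.trueAction ω t ((G.trueLayers ω).getD (t + 1) []) x) G.jointList)
      ((G.prunedLayers ω).getD t [])) (List.range G.H)

variable (G) in
/-- The output of the feasibility computation for a feasible game. -/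
noncomputable def feasibleSets : G.FeasibleSets :=
  ⟨fun t => (G.prunedLayers ω).getD t [], (G.actionTable ω).val⟩

theorem root_val : (memList (G := G) ω (G.s₁, 0) ((G.trueLayers ω).headD [])).val = true ↔
    G.Live G.H 0 (G.s₁, 0) := by
  have : (G.trueLayers ω).headD [] = (G.trueLayers ω).getD 0 [] := by
    cases G.trueLayers ω <;> rfl
  rw [memList_val, this, mem_trueLayers ω (Nat.zero_le _)]
  simp [reach_zero]

/-- Names the intermediate results, so that values and times can be treated separately. -/
theorem feasibility_eq : G.feasibility ω = (do
    let _ ← G.forward ω G.H 0 [(G.s₁, 0)]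
    let _ ← G.evaluate ω 0 (G.layers ω)
    let b ← memList (G := G) ω (G.s₁, 0) ((G.trueLayers ω).headD [])
    if b then do
      let _ ← G.prune ω 0 [(G.s₁, 0)] (G.trueLayers ω).tail
      let _ ← G.actionTable ω
      pure (some (G.feasibleSets ω))
    else pure none) := rfl

theorem feasibility_val (h0 : G.Live G.H 0 (G.s₁, 0)) :
    (G.feasibility ω).val = some (G.feasibleSets ω) := by
  rw [feasibility_eq]
  simp only [Timed.bind_val, (root_val ω).2 h0, if_true, Timed.pure_val]

theorem feasibility_val_none (h0 : ¬ G.Live G.H 0 (G.s₁, 0)) :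
    (G.feasibility ω).val = none := by
  rw [feasibility_eq]
  have : (memList (G := G) ω (G.s₁, 0) ((G.trueLayers ω).headD [])).val = false := by
    rw [← Bool.not_eq_true, root_val]; exact h0
  simp only [Timed.bind_val, this, Bool.false_eq_true, if_false, Timed.pure_val]

theorem mem_RS (t : ℕ) (x : G.Node) :
    x ∈ (G.feasibleSets ω).RS t ↔ t ≤ G.H ∧ G.Reach G.Safe t x := by
  rcases le_or_gt t G.H with ht | ht
  · exact (mem_prunedLayers ω ht x).trans (by simp [ht])
  · simp only [feasibleSets]
    rw [List.getD_eq_default _ _ (by rw [prunedLayers_length]; omega)]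
    simp [ht]

theorem mem_RA (t : ℕ) (x : G.Node) (a : Joint G.k) :
    a ∈ (G.feasibleSets ω).RA t x ↔ t < G.H ∧ G.Reach G.Safe t x ∧ G.Safe t x a := by
  simp only [feasibleSets, actionTable, Timed.tabulate_val, List.mem_range]
  by_cases ht : t < G.H
  · rw [if_pos ht, Timed.tabulate_val]
    have hmem := mem_prunedLayers ω ht.le x
    by_cases hx : G.Reach G.Safe t x
    · rw [if_pos (hmem.2 hx), Timed.filter_val, List.mem_filter, trueAction_val ω
        (mem_trueLayers ω (Nat.succ_le_of_lt ht)) (hx.mono fun _ _ _ h => h.affordable)]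
      simp [ht, hx]
    · rw [if_neg fun h => hx (hmem.1 h)]
      simp [hx]
  · simp [ht]

/-! ### Correctness of the constructed tables. -/

theorem transRow_val (t : ℕ) (x : G.Node) (a : Joint G.k) :
    (G.transRow ω t x a).val = G.transTable t x a := by
  rw [transRow, Timed.fold_val_add (g := fun c => ∑ s : Fin G.S,
    Finsupp.single (s, x.2 + c) ((G.C t x.1 a c).toReal * (G.P t x.1 a s).toReal))]
  · rw [zero_add, Finset.sum_map_toList]; rfl
  · intro w c
    rw [Timed.bind_val, Timed.fold_val_add (g := fun s =>
      Finsupp.single (s, x.2 + c) ((G.C t x.1 a c).toReal * (G.P t x.1 a s).toReal))]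
    · rw [stateList, Finset.sum_map_toList]
    · intro w s; rfl

/-- Equality of the whole tables, including the default entries, is required: the solver is an
arbitrary function of the game, and membership in the class is assumed for the reduced game only. -/
theorem construct_val (h0 : G.Live G.H 0 (G.s₁, 0)) :
    (G.construct ω (G.feasibleSets ω)).val = G.reducedTables := by
  have hiff : ∀ t x a, (t < G.H ∧ x ∈ G.FS t ∧ a ∈ G.FA t x) ↔
      a ∈ (G.feasibleSets ω).RA t x := by
    intro t x a
    rw [mem_RA]
    refine and_congr_right fun ht => ?_
    rw [mem_FS h0 ht.le, mem_FA h0 ht]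
    tauto
  -- The three nested tabulations collapse to one condition, since an action is listed in `RA t x`
  -- only if `t` and `x` are listed too.
  have hdeep : ∀ {β : Type} (d : β) (f : ℕ → G.Node → Joint G.k → Timed β) t x a,
      (Timed.tabulate (fun _ _ => d) (fun t => Timed.tabulate (fun _ => d) (fun x =>
        Timed.tabulate d (f t x) ((G.feasibleSets ω).RA t x)) ((G.feasibleSets ω).RS t))
          (List.range G.H)).val t x a =
        if a ∈ (G.feasibleSets ω).RA t x then (f t x a).val else d := by
    intro β d f t x a
    rw [Timed.tabulate_val]
    have hm := mem_RA ω t x a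
    have hs := mem_RS ω t x
    split_ifs with h1 h2 h2
    · rw [Timed.tabulate_val, if_pos (hs.2 ⟨(hm.1 h2).1.le, (hm.1 h2).2.1⟩), Timed.tabulate_val,
        if_pos h2]
    · rw [Timed.tabulate_val]
      split_ifs
      · rw [Timed.tabulate_val, if_neg h2]
      · rfl
    · exact absurd (List.mem_range.2 (hm.1 h2).1) h1
    · rfl
  simp only [construct, reducedTables, Timed.bind_val, Timed.pure_val]
  congr 1
  · funext t
    ext x
    rw [List.mem_toFinset, mem_RS]
    split_ifs with ht
    · simp [ht, mem_FS h0 ht]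
    · simp [ht]
  · funext t x
    ext a
    rw [List.mem_toFinset, mem_RA]
    split_ifs with ht
    · simp [ht, mem_FA h0 ht]
    · simp [ht]
  · funext t x a
    rw [hdeep]
    simp only [hiff, transRow_val]
    rfl
  · funext t x a
    rw [hdeep]
    simp only [hiff]
    rfl

theorem reduction_eq_of_live (MGSolve : (Γ : ACGame) → Timed Γ.Policy)
    (h0 : G.Live G.H 0 (G.s₁, 0)) :
    (reduction ω MGSolve G).val =
        some ⟨G.reducedTables, (MGSolve G.reducedTables.game).val⟩ ∧
      (reduction ω MGSolve G).time = (G.feasibility ω).time +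
        (G.construct ω (G.feasibleSets ω)).time + (MGSolve G.reducedTables.game).time := by
  simp only [reduction, Timed.bind_val, Timed.bind_time, feasibility_val ω h0,
    Timed.pure_val, Timed.pure_time]
  have h := construct_val ω h0
  -- The type of the solver's policy depends on the tables, so they are made a variable and
  -- substituted rather than rewritten.
  generalize (G.construct ω (G.feasibleSets ω)).val = T at h
  subst h
  exact ⟨rfl, by omega⟩

theorem reduction_eq_of_not_live (MGSolve : (Γ : ACGame) → Timed Γ.Policy)
    (h0 : ¬ G.Live G.H 0 (G.s₁, 0)) :
    (reduction ω MGSolve G).val = none ∧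
      (reduction ω MGSolve G).time = (G.feasibility ω).time := by
  simp only [reduction, Timed.bind_val, Timed.bind_time, feasibility_val_none ω h0,
    Timed.pure_val, Timed.pure_time]
  exact ⟨trivial, rfl⟩

end ACMG

/-! ## Sizes of numbers -/

namespace CostModel

theorem numSize_unit (x : ℝ) : unit.numSize x = 1 := rfl

theorem numSize_bit_ratCast (q : ℚ) :
    bit.numSize (q : ℝ) = q.num.natAbs.size + q.den.size + 1 := by
  have h : ∃ q' : ℚ, (q' : ℝ) = q := ⟨q, rfl⟩
  have h2 : h.choose = q := Rat.cast_injective h.choose_spec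
  simp only [numSize]
  rw [dif_pos h, h2]

theorem one_le_numSize (ω : CostModel) (x : ℝ) : 1 ≤ ω.numSize x := by
  cases ω
  · exact le_rfl
  · simp only [numSize]
    split_ifs <;> omega

/-- Reduction to lowest terms only shrinks numerator and denominator, so any representation as a
fraction bounds the size. -/
theorem numSize_bit_div_le (u : ℤ) (v : ℕ) (hv : 0 < v) :
    bit.numSize ((u : ℝ) / v) ≤ u.natAbs.size + v.size + 1 := by
  have h : (u : ℝ) / v = (((u : ℚ) / ((v : ℤ) : ℚ) : ℚ) : ℝ) := by push_cast; rfl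
  rw [h, numSize_bit_ratCast]
  have hv' : (v : ℤ) ≠ 0 := by exact_mod_cast hv.ne'
  have h1 := Rat.num_dvd u hv'
  rw [Rat.divInt_eq_div] at h1
  have h2 := Rat.den_dvd u v
  have h3 : ((u : ℚ) / ((v : ℤ) : ℚ)).den ≤ v := Nat.le_of_dvd hv (by exact_mod_cast h2)
  have h4 : ((u : ℚ) / ((v : ℤ) : ℚ)).num.natAbs ≤ u.natAbs := by
    rcases eq_or_ne u 0 with rfl | hu
    · simp
    · exact Nat.le_of_dvd (Int.natAbs_pos.2 hu) (Int.natAbs_dvd_natAbs.2 h1)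
  have := Nat.size_le_size h3
  have := Nat.size_le_size h4
  omega

theorem size_mul_le (a b : ℕ) : (a * b).size ≤ a.size + b.size := by
  rw [Nat.size_le, pow_add]
  exact Nat.mul_lt_mul'' (Nat.lt_size_self a) (Nat.lt_size_self b)

theorem numSize_mul_le (ω : CostModel) {x y : ℝ} (hx : ω.Stores x) (hy : ω.Stores y) :
    ω.numSize (x * y) ≤ ω.numSize x + ω.numSize y := by
  cases ω
  · simp [numSize_unit]
  · obtain ⟨p, rfl⟩ := hx
    obtain ⟨q, rfl⟩ := hy
    have h : (p : ℝ) * q = ((p.num * q.num : ℤ) : ℝ) / ((p.den * q.den : ℕ) : ℝ) := by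
      rw [Rat.cast_def p, Rat.cast_def q, div_mul_div_comm]; push_cast; rfl
    rw [h, numSize_bit_ratCast, numSize_bit_ratCast]
    refine (numSize_bit_div_le _ _ (Nat.mul_pos p.pos q.pos)).trans ?_
    rw [Int.natAbs_mul]
    have := size_mul_le p.num.natAbs q.num.natAbs
    have := size_mul_le p.den q.den
    omega

end CostModel

/-! ## Running times of loops -/

namespace Timed

variable {α β : Type}

/-- The invariant `I` is there for bodies whose cost depends on the accumulator, such as insertion
into a growing list. -/
theorem fold_time {f : β → α → Timed β} {I : β → Prop} {M : ℕ} {l : List α}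
    (h : ∀ b, ∀ a ∈ l, I b → (f b a).time ≤ M ∧ I (f b a).val) {b : β} (hb : I b) :
    (fold f b l).time ≤ l.length * (1 + M) ∧ I (fold f b l).val := by
  induction l generalizing b with
  | nil => exact ⟨by simp [fold], hb⟩
  | cons a l ih =>
    obtain ⟨h1, h2⟩ := h b a List.mem_cons_self hb
    obtain ⟨h3, h4⟩ := ih (fun b a ha => h b a (List.mem_cons_of_mem _ ha)) h2
    refine ⟨?_, h4⟩
    simp only [fold_cons, bind_time, tick_time, List.length_cons]
    rw [add_mul, one_mul]
    omega

theorem fold_time' {f : β → α → Timed β} {M : ℕ} {l : List α}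
    (h : ∀ b, ∀ a ∈ l, (f b a).time ≤ M) (b : β) : (fold f b l).time ≤ l.length * (1 + M) :=
  (fold_time (I := fun _ => True) (fun b a ha _ => ⟨h b a ha, trivial⟩) trivial).1

theorem all_time {p : α → Timed Bool} {M : ℕ} {l : List α} (h : ∀ a ∈ l, (p a).time ≤ M) :
    (all p l).time ≤ l.length * (1 + M) :=
  fold_time' (fun _ a ha => by simpa using h a ha) _

theorem any_time {p : α → Timed Bool} {M : ℕ} {l : List α} (h : ∀ a ∈ l, (p a).time ≤ M) :
    (any p l).time ≤ l.length * (1 + M) :=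
  fold_time' (fun _ a ha => by simpa using h a ha) _

theorem filter_time {p : α → Timed Bool} {M : ℕ} {l : List α} (h : ∀ a ∈ l, (p a).time ≤ M) :
    (filter p l).time ≤ l.length * (1 + M) := by
  induction l with
  | nil => simp [filter]
  | cons a l ih =>
    have h1 := h a List.mem_cons_self
    have h2 := ih fun a ha => h a (List.mem_cons_of_mem _ ha)
    simp only [filter, bind_time, tick_time, pure_time, List.length_cons]
    rw [add_mul, one_mul]
    omega

theorem tabulate_time [DecidableEq α] {d : β} {f : α → Timed β} {M : ℕ} {l : List α}
    (h : ∀ a ∈ l, (f a).time ≤ M) : (tabulate d f l).time ≤ l.length * (1 + M) := by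
  induction l with
  | nil => simp [tabulate]
  | cons a l ih =>
    have h1 := h a List.mem_cons_self
    have h2 := ih fun a ha => h a (List.mem_cons_of_mem _ ha)
    simp only [tabulate, bind_time, tick_time, pure_time, List.length_cons]
    rw [add_mul, one_mul]
    omega

end Timed

namespace ACMG

open Play

variable {G : ACMG}

/-! ## Counting nodes -/

variable (G) in
/-- The cumulative costs counted by `D`. -/
def costSet : Set (Fin G.n → ℝ) :=
  {c | ∃ (π : HPolicy (Joint G.k) G.Obs) (τ : Hist (Joint G.k) G.Obs),
    τ.length ≤ G.H ∧ G.Realizes π τ ∧ G.cum τ = c ∧ c ≤ G.B}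

variable (G) in
theorem costSet_finite : G.costSet.Finite := by
  have h : (⋃ m ∈ Finset.range (G.H + 1), G.cum ''
      {τ | ∃ π : HPolicy (Joint G.k) G.Obs, τ ∈ (rollout G.kernel π m []).support}).Finite :=
    (Finset.finite_toSet _).biUnion fun m _ =>
      (Play.finite_realizable G.kernel G.kernel_finite m []).image G.cum
  refine h.subset ?_
  rintro c ⟨π, τ, hl, hr, rfl, -⟩
  refine Set.mem_biUnion (x := τ.length) (by simp; omega) ⟨τ, ⟨π, ?_⟩, rfl⟩
  exact (PMF.mem_support_iff _ _).2 hr.ne'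

variable (G) in
theorem card_costSet : G.costSet_finite.toFinset.card = G.D :=
  (Set.ncard_eq_toFinset_card _ _).symm

/-- The uniform policy on all joint actions realizes the node, and affordability of the last action
gives the budget. The root is excluded: its cost 0 may exceed the budget and is then not counted by
D. -/
theorem Reach.mem_costSet {t : ℕ} {x : G.Node} (hx : G.Reach G.Affordable (t + 1) x)
    (ht : t + 1 ≤ G.H) : x.2 ∈ G.costSet := by
  have := G.joint_nonempty
  have hB : x.2 ≤ G.B := by
    cases hx with
    | step _ ha hc _ => exact ha _ hc
  obtain ⟨τ, h1, h2, rfl⟩ := hx.realizes (π := fun _ => PMF.uniformOfFintype _)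
    (fun τ _ _ a _ => by simp) ht
  exact ⟨_, τ, h1.trans_le ht, h2, rfl, hB⟩

theorem card_le_of_snd_mem (s : Finset G.Node) (u : Finset (Fin G.n → ℝ))
    (h : ∀ x ∈ s, x.2 ∈ u) : s.card ≤ G.S * u.card := by
  have hsub : s ⊆ Finset.univ ×ˢ u := fun x hx => by simpa using h x hx
  simpa using Finset.card_le_card hsub

theorem card_le_of_reach {s : Finset G.Node} {t : ℕ} (ht : t ≤ G.H)
    (h : ∀ x ∈ s, G.Reach G.Affordable t x) : s.card ≤ G.S * (G.D + 1) := by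
  classical
  refine (card_le_of_snd_mem s (insert 0 G.costSet_finite.toFinset) fun x hx => ?_).trans
    (Nat.mul_le_mul_left _ ?_)
  · cases t with
    | zero => simp [reach_zero.1 (h x hx)]
    | succ t => simp [(h x hx).mem_costSet ht]
  · exact (Finset.card_insert_le _ _).trans (by rw [card_costSet])

/-- The sharp form without `+ 1`, needed for the space bound. The root layer is a single state, so
there it suffices that S and D are positive. -/
theorem card_reduced_states_le (h0 : G.Live G.H 0 (G.s₁, 0)) {t : ℕ} (ht : t < G.H) :
    (G.reducedTables.states t).card ≤ G.S * G.D := by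
  have hmem := mem_reduced_states h0 ht.le
  cases t with
  | succ t =>
    rw [← card_costSet]
    refine card_le_of_snd_mem _ _ fun x hx => ?_
    have hx := ((hmem x).1 hx).mono fun _ _ _ h => h.affordable
    simpa using hx.mem_costSet ht.le
  | zero =>
    have h1 : (G.reducedTables.states 0).card ≤ 1 := by
      refine Finset.card_le_one.2 fun x hx y hy => ?_
      rw [reach_zero.1 ((hmem x).1 hx), reach_zero.1 ((hmem y).1 hy)]
    -- A live root before the horizon has a safe action, and any cost it can incur is counted by D.
    have hD : 0 < G.D := by
      obtain ⟨a, ha⟩ := (G.live_iff_exists_safe ht _).1 h0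
      obtain ⟨c, hc⟩ := (G.C 0 G.s₁ a).support_nonempty
      obtain ⟨s, hs⟩ := (G.P 0 G.s₁ a).support_nonempty
      have := (Reach.step (ok := G.Affordable) .root ha.affordable
        ((G.mem_costs _ _ _ c).2 hc) hs).mem_costSet ht
      rw [← card_costSet]
      exact Finset.card_pos.2 ⟨_, by simpa using this⟩
    have hS : 0 < G.S := G.s₁.pos
    exact h1.trans (Nat.mul_pos hS hD)

/-! ## Sizes of the numbers in the description of the game -/

variable (G) in
/-- The part of the description belonging to one round, state and joint action. -/
noncomputable def rowSize (ω : CostModel) (t : ℕ) (s : Fin G.S) (a : Joint G.k) : ℕ :=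
  1 + ∑ s', ω.numSize (G.P t s a s').toReal + ∑ i, ω.numSize (G.r t s a i) +
    ∑ c ∈ G.costs t s a, (ω.numSize (G.C t s a c).toReal + ∑ i, ω.numSize (c i))

theorem sum_rowSize_le (ω : CostModel) {t : ℕ} (ht : t < G.H) (s : Fin G.S) :
    ∑ a, G.rowSize ω t s a ≤ G.size ω := by
  have h1 : ∑ a, G.rowSize ω t s a ≤ ∑ s, ∑ a, G.rowSize ω t s a :=
    Finset.single_le_sum (f := fun s => ∑ a, G.rowSize ω t s a) (fun _ _ => Nat.zero_le _)
      (Finset.mem_univ s)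
  have h2 : ∑ s, ∑ a, G.rowSize ω t s a ≤
      ∑ t ∈ Finset.range G.H, ∑ s, ∑ a, G.rowSize ω t s a :=
    Finset.single_le_sum (f := fun t => ∑ s, ∑ a, G.rowSize ω t s a) (fun _ _ => Nat.zero_le _)
      (Finset.mem_range.2 ht)
  exact (h1.trans h2).trans (Nat.le_add_left _ _)

theorem rowSize_le (ω : CostModel) {t : ℕ} (ht : t < G.H) (s : Fin G.S) (a : Joint G.k) :
    G.rowSize ω t s a ≤ G.size ω :=
  (Finset.single_le_sum (f := fun a => G.rowSize ω t s a) (fun _ _ => Nat.zero_le _)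
    (Finset.mem_univ a)).trans (sum_rowSize_le ω ht s)

/-- All quantities entering the running time are bounded by powers of `N`. -/
structure Bound (G : ACMG) (ω : CostModel) (N : ℕ) : Prop where
  two_le : 2 ≤ N
  H_le : G.H ≤ N
  S_le : G.S ≤ N
  n_le : G.n ≤ N
  k_le : ∑ i, G.k i ≤ N
  B_le : ∀ i, ω.numSize (G.B i) ≤ N
  joint_le : ∀ t < G.H, Fintype.card (Joint G.k) ≤ N
  costs_le : ∀ t < G.H, ∀ s a, (G.costs t s a).card ≤ N
  P_le : ∀ t < G.H, ∀ s a s', ω.numSize (G.P t s a s').toReal ≤ N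
  r_le : ∀ t < G.H, ∀ s a i, ω.numSize (G.r t s a i) ≤ N
  C_le : ∀ t < G.H, ∀ s a, ∀ c ∈ G.costs t s a, ω.numSize (G.C t s a c).toReal ≤ N
  c_le : ∀ t < G.H, ∀ s a, ∀ c ∈ G.costs t s a, ∀ i, ω.numSize (c i) ≤ N
  P_stored : ∀ t < G.H, ∀ s a s', ω.Stores (G.P t s a s').toReal
  C_stored : ∀ t < G.H, ∀ s a, ∀ c ∈ G.costs t s a, ω.Stores (G.C t s a c).toReal
  cum_le : ∀ t ≤ G.H, ∀ x, G.Reach (fun _ _ _ => True) t x → ∀ i, ω.numSize (x.2 i) ≤ N ^ 3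
  card_le : ∀ t ≤ G.H, ∀ s : Finset G.Node, (∀ x ∈ s, G.Reach G.Affordable t x) → s.card ≤ N ^ 2

/-- Adding fractions without reduction multiplies denominators, so lengths grow linearly in the
number of rounds, and the numerator gains a factor of at most `t`. -/
theorem numSize_cum_le (ω : CostModel) {L : ℕ}
    (hs : ∀ t < G.H, ∀ s a, ∀ c ∈ G.costs t s a, ∀ i, ω.Stores (c i))
    (hL : ∀ t < G.H, ∀ s a, ∀ c ∈ G.costs t s a, ∀ i, ω.numSize (c i) ≤ L)
    {t : ℕ} (ht : t ≤ G.H) {x : G.Node} (hx : G.Reach (fun _ _ _ => True) t x) (i : Fin G.n) :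
    ω.numSize (x.2 i) ≤ t + 2 * (t * L) + 2 := by
  cases ω with
  | unit => rw [CostModel.numSize_unit]; omega
  | bit =>
    obtain ⟨u, v, hv, h, hu, hv'⟩ : ∃ (u : ℤ) (v : ℕ), 0 < v ∧ x.2 i = (u : ℝ) / v ∧
        u.natAbs ≤ t * 2 ^ (t * L) ∧ v ≤ 2 ^ (t * L) := by
      induction hx with
      | root => exact ⟨0, 1, one_pos, by simp, by simp, by simp⟩
      | @step t x a c s _ _ hc _ ih =>
        obtain ⟨u, v, hv, h, hu, hv'⟩ := ih (by omega)
        obtain ⟨q, hq⟩ := hs t (by omega) _ a c hc i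
        have hqL := hL t (by omega) _ a c hc i
        rw [← hq, CostModel.numSize_bit_ratCast] at hqL
        have hnum : q.num.natAbs ≤ 2 ^ L :=
          (Nat.lt_size_self _).le.trans (Nat.pow_le_pow_right two_pos (by omega))
        have hden : q.den ≤ 2 ^ L :=
          (Nat.lt_size_self _).le.trans (Nat.pow_le_pow_right two_pos (by omega))
        have hpow : 2 ^ ((t + 1) * L) = 2 ^ (t * L) * 2 ^ L := by rw [← pow_add]; ring_nf
        refine ⟨u * q.den + q.num * v, v * q.den, Nat.mul_pos hv q.pos, ?_, ?_, ?_⟩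
        · change x.2 i + c i = _
          rw [h, ← hq, Rat.cast_def q]
          have h1 : (v : ℝ) ≠ 0 := by exact_mod_cast hv.ne'
          have h2 : (q.den : ℝ) ≠ 0 := by exact_mod_cast q.den_ne_zero
          push_cast
          field_simp
        · calc (u * q.den + q.num * v).natAbs
              ≤ u.natAbs * q.den + q.num.natAbs * v := by
                refine (Int.natAbs_add_le _ _).trans ?_
                simp [Int.natAbs_mul]
            _ ≤ t * 2 ^ (t * L) * 2 ^ L + 2 ^ L * 2 ^ (t * L) := by gcongr
            _ = (t + 1) * 2 ^ ((t + 1) * L) := by rw [hpow]; ring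
        · rw [hpow]
          exact Nat.mul_le_mul hv' hden
    rw [h]
    refine (CostModel.numSize_bit_div_le u v hv).trans ?_
    have h1 : u.natAbs.size ≤ t + t * L := by
      rw [Nat.size_le, pow_add]
      exact hu.trans_lt (Nat.mul_lt_mul_of_pos_right Nat.lt_two_pow_self (by positivity))
    have h2 : v.size ≤ t * L + 1 := by
      rw [Nat.size_le]
      exact hv'.trans_lt (Nat.pow_lt_pow_right one_lt_two (Nat.lt_succ_self _))
    omega

theorem bound_of_stored {ω : CostModel} (h : G.StoredIn ω) :
    G.Bound ω (G.size ω + G.D + 16) := by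
  -- The 16 gives `2 ≤ N`, makes `D + 1 ≤ N`, and lets `N ^ 3` absorb the bound `N + 2 * N ^ 2 + 2`
  -- on cumulative costs.
  set N := G.size ω + G.D + 16 with hN
  have hsz : G.size ω ≤ N := by omega
  have hrow : ∀ t < G.H, ∀ s a, G.rowSize ω t s a ≤ N := fun t ht s a =>
    (rowSize_le ω ht s a).trans hsz
  have hmain : G.H + G.S + G.n + ∑ i, G.k i + ∑ i, ω.numSize (G.B i) ≤ N :=
    le_trans (Nat.le_add_right _ _) hsz
  have hc : ∀ t < G.H, ∀ s a, ∀ c ∈ G.costs t s a,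
      ω.numSize (G.C t s a c).toReal + ∑ i, ω.numSize (c i) ≤ N := by
    intro t ht s a c hc
    refine le_trans ?_ (hrow t ht s a)
    refine le_trans ?_ (Nat.le_add_left _ _)
    exact Finset.single_le_sum (f := fun c => ω.numSize (G.C t s a c).toReal +
      ∑ i, ω.numSize (c i)) (fun _ _ => Nat.zero_le _) hc
  have hci : ∀ t < G.H, ∀ s a, ∀ c ∈ G.costs t s a, ∀ i, ω.numSize (c i) ≤ N := by
    intro t ht s a c hc' i
    have := hc t ht s a c hc'
    have := Finset.single_le_sum (f := fun i => ω.numSize (c i)) (fun _ _ => Nat.zero_le _)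
      (Finset.mem_univ i)
    omega
  refine ⟨by omega, by omega, by omega, by omega, by omega, ?_, ?_, ?_, ?_, ?_, ?_, hci, ?_, ?_,
    ?_, ?_⟩
  · intro i
    have := Finset.single_le_sum (f := fun i => ω.numSize (G.B i)) (fun _ _ => Nat.zero_le _)
      (Finset.mem_univ i)
    omega
  -- The number of joint actions is bounded through the table rows, each of size at least 1; this
  -- requires a round, and `s₁` supplies a state.
  · intro t ht
    refine le_trans ?_ ((sum_rowSize_le ω ht G.s₁).trans hsz)
    rw [← Finset.card_univ, Finset.card_eq_sum_ones]
    exact Finset.sum_le_sum fun a _ => by rw [rowSize]; omega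
  · intro t ht s a
    refine le_trans ?_ (hrow t ht s a)
    refine le_trans ?_ (Nat.le_add_left _ _)
    rw [Finset.card_eq_sum_ones]
    exact Finset.sum_le_sum fun c _ => (ω.one_le_numSize _).trans (Nat.le_add_right _ _)
  · intro t ht s a s'
    have h1 := hrow t ht s a
    rw [rowSize] at h1
    have := Finset.single_le_sum (f := fun s' => ω.numSize (G.P t s a s').toReal)
      (fun _ _ => Nat.zero_le _) (Finset.mem_univ s')
    omega
  · intro t ht s a i
    have h1 := hrow t ht s a
    rw [rowSize] at h1
    have := Finset.single_le_sum (f := fun i => ω.numSize (G.r t s a i))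
      (fun _ _ => Nat.zero_le _) (Finset.mem_univ i)
    omega
  · intro t ht s a c hc'
    have := hc t ht s a c hc'
    omega
  · exact fun t ht s a => (h.2 t ht s a).1
  · exact fun t ht s a c hc => ((h.2 t ht s a).2.2 c hc).1
  · intro t ht x hx i
    refine (numSize_cum_le ω (fun t ht s a c hc => ((h.2 t ht s a).2.2 c hc).2)
      hci ht hx i).trans ?_
    have ht' : t ≤ N := by omega
    have hN16 : 16 ≤ N := by omega
    calc t + 2 * (t * N) + 2 ≤ N + 2 * (N * N) + 2 := by gcongr
      _ ≤ N ^ 3 := by nlinarith [Nat.mul_le_mul hN16 (Nat.mul_le_mul hN16 (le_refl N)),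
          Nat.mul_le_mul hN16 (le_refl (N * N)), Nat.mul_le_mul hN16 hN16]
  · intro t ht s hs
    refine (card_le_of_reach ht hs).trans ?_
    rw [pow_two]
    exact Nat.mul_le_mul (by omega) (by omega)

end ACMG

/-! ## Bounds by powers -/

/-- With this rule sums cost one exponent, while products add exponents; all explicit exponents
below arise in this way, often rounded up. -/
theorem add_le_pow {N x y a b : ℕ} (hN : 2 ≤ N) (hx : x ≤ N ^ a) (hy : y ≤ N ^ b) :
    x + y ≤ N ^ (max a b + 1) := by
  have hN' : 0 < N := by omega
  have h1 := Nat.pow_le_pow_right hN' (le_max_left a b)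
  have h2 := Nat.pow_le_pow_right hN' (le_max_right a b)
  calc x + y ≤ N ^ max a b * 2 := by omega
    _ ≤ N ^ max a b * N := Nat.mul_le_mul_left _ hN
    _ = _ := (pow_succ _ _).symm

theorem mul_le_pow {N x y a b : ℕ} (hx : x ≤ N ^ a) (hy : y ≤ N ^ b) : x * y ≤ N ^ (a + b) := by
  rw [pow_add]; exact Nat.mul_le_mul hx hy

theorem one_add_le_pow {N x a : ℕ} (hN : 2 ≤ N) (hx : x ≤ N ^ a) : 1 + x ≤ N ^ (a + 1) := by
  simpa using add_le_pow hN (Nat.one_le_pow 0 N (by omega)) hx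

theorem pow_mono_of_two_le {N x a b : ℕ} (hN : 2 ≤ N) (hx : x ≤ N ^ a) (h : a ≤ b) :
    x ≤ N ^ b :=
  hx.trans (Nat.pow_le_pow_right (by omega) h)

theorem sum_le_pow {ι : Type} {N a b : ℕ} {s : Finset ι} {f : ι → ℕ} (hs : s.card ≤ N ^ a)
    (hf : ∀ i ∈ s, f i ≤ N ^ b) : ∑ i ∈ s, f i ≤ N ^ (a + b) := by
  refine (Finset.sum_le_card_nsmul s f _ hf).trans ?_
  rw [smul_eq_mul]
  exact mul_le_pow hs le_rfl

/-! ### Running times of the building blocks. -/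

namespace ACMG

namespace Bound

variable {G : ACMG} {ω : CostModel} {N : ℕ}

/-- `L` lists distinct nodes of the AND/OR graph at round `t`. -/
def IsLayer (G : ACMG) (t : ℕ) (L : List G.Node) : Prop :=
  L.Nodup ∧ ∀ x ∈ L, G.Reach G.Affordable t x

/-- The lists are layers of the AND/OR graph at successive rounds. -/
def AreLayers (G : ACMG) : ℕ → List (List G.Node) → Prop
  | _, [] => True
  | t, L :: Ls => IsLayer G t L ∧ AreLayers G (t + 1) Ls

theorem AreLayers.getD {t : ℕ} {Ls : List (List G.Node)} (h : AreLayers G t Ls) (j : ℕ) :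
    IsLayer G (t + j) (Ls.getD j []) := by
  induction Ls generalizing t j with
  | nil => exact ⟨List.nodup_nil, by simp⟩
  | cons L Ls ih =>
    cases j with
    | zero => exact h.1
    | succ j =>
      have := ih h.2 j
      rwa [show t + 1 + j = t + (j + 1) by omega] at this

theorem isLayer_root : IsLayer G 0 [(G.s₁, 0)] :=
  ⟨by simp, fun x hx => by rw [List.mem_singleton.1 hx]; exact .root⟩

theorem sum_fin_le (hb : G.Bound ω N) {k : ℕ} {f : Fin G.n → ℕ} (hf : ∀ i, f i ≤ N ^ k) :
    ∑ i, f i ≤ N ^ (1 + k) :=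
  sum_le_pow (by simpa using hb.n_le) fun i _ => hf i

theorem layer_length (hb : G.Bound ω N) {t : ℕ} (ht : t ≤ G.H) {L : List G.Node}
    (hL : IsLayer G t L) : L.length ≤ N ^ 2 := by
  classical
  rw [← List.toFinset_card_of_nodup hL.1]
  exact hb.card_le t ht _ fun x hx => hL.2 x (List.mem_toFinset.1 hx)

theorem costs_length (hb : G.Bound ω N) {t : ℕ} (ht : t < G.H) (s : Fin G.S) (a : Joint G.k) :
    (G.costs t s a).toList.length ≤ N ^ 1 := by
  simpa using hb.costs_le t ht s a

theorem stateList_length (hb : G.Bound ω N) : G.stateList.length ≤ N ^ 1 := by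
  simpa [stateList] using hb.S_le

theorem jointList_length (hb : G.Bound ω N) {t : ℕ} (ht : t < G.H) :
    G.jointList.length ≤ N ^ 1 := by
  simpa [jointList] using hb.joint_le t ht

theorem numSize_node (hb : G.Bound ω N) {t : ℕ} (ht : t ≤ G.H) {x : G.Node}
    (hx : G.Reach (fun _ _ _ => True) t x) (i : Fin G.n) : ω.numSize (x.2 i) ≤ N ^ 3 :=
  hb.cum_le t ht x hx i

theorem nodeSize_le (hb : G.Bound ω N) {x : G.Node} (hx : ∀ i, ω.numSize (x.2 i) ≤ N ^ 3) :
    nodeSize ω x ≤ N ^ 5 :=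
  one_add_le_pow hb.two_le (hb.sum_fin_le hx)

/-- Each coordinate costs at most the cube of `N ^ 4`; the number of players and the extra step add
one exponent each. -/
theorem vector_time (hb : G.Bound ω N) {c d : Fin G.n → ℝ} (hc : ∀ i, ω.numSize (c i) ≤ N ^ 3)
    (hd : ∀ i, ω.numSize (d i) ≤ N ^ 3) : 1 + ∑ i, ω.opCost (c i) (d i) ≤ N ^ 14 := by
  refine one_add_le_pow hb.two_le (hb.sum_fin_le (k := 12) fun i => ?_)
  refine (Nat.pow_le_pow_left (add_le_pow hb.two_le (hc i) (hd i)) 3).trans ?_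
  rw [← pow_mul]
  norm_num

theorem numSize_pow (hb : G.Bound ω N) {p : ℝ} (hp : ω.numSize p ≤ N) : ω.numSize p ≤ N ^ 3 :=
  pow_mono_of_two_le hb.two_le (hp.trans_eq (pow_one N).symm) (by norm_num)

theorem addCost_time (hb : G.Bound ω N) {t : ℕ} (ht : t < G.H) {x : G.Node}
    (hx : G.Reach (fun _ _ _ => True) t x) {a : Joint G.k} {c : Fin G.n → ℝ}
    (hc : c ∈ G.costs t x.1 a) : (addCost (G := G) ω x.2 c).time ≤ N ^ 14 :=
  hb.vector_time (hb.numSize_node ht.le hx) fun i => hb.numSize_pow (hb.c_le t ht _ a c hc i)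

theorem numSize_next (hb : G.Bound ω N) {t : ℕ} (ht : t < G.H) {x : G.Node}
    (hx : G.Reach (fun _ _ _ => True) t x) {a : Joint G.k} {c : Fin G.n → ℝ}
    (hc : c ∈ G.costs t x.1 a) (i : Fin G.n) : ω.numSize ((x.2 + c) i) ≤ N ^ 3 := by
  obtain ⟨s, hs⟩ := (G.P t x.1 a).support_nonempty
  exact hb.numSize_node (Nat.succ_le_of_lt ht) (Reach.step hx trivial hc hs) i

theorem feasibleAction_time (hb : G.Bound ω N) {t : ℕ} (ht : t < G.H) {x : G.Node}
    (hx : G.Reach (fun _ _ _ => True) t x) (a : Joint G.k) :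
    (G.feasibleAction ω t x a).time ≤ N ^ 17 := by
  refine (Timed.all_time (M := N ^ 15) fun c hc => ?_).trans
    (mul_le_pow (hb.costs_length ht _ _) (one_add_le_pow hb.two_le le_rfl))
  rw [Finset.mem_toList] at hc
  exact add_le_pow hb.two_le (hb.addCost_time ht hx hc)
    (hb.vector_time (hb.numSize_next ht hx hc) fun i => hb.numSize_pow (hb.B_le i))

theorem children_time (hb : G.Bound ω N) {t : ℕ} (ht : t < G.H) {x : G.Node}
    (hx : G.Reach (fun _ _ _ => True) t x) (a : Joint G.k) :
    (G.children ω t x a).time ≤ N ^ 17 ∧ (G.children ω t x a).val.length ≤ N ^ 2 := by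
  have hinner : ∀ (acc : List G.Node) (c : Fin G.n → ℝ), c ∈ G.costs t x.1 a →
      (Timed.fold (fun acc s => do
        let b ← isPositive ω (G.P t x.1 a s).toReal
        if b then do
          Timed.tick (nodeSize (G := G) ω (s, x.2 + c))
          pure ((s, x.2 + c) :: acc)
        else pure acc) acc G.stateList).time ≤ N ^ 8 := by
    intro acc c hc
    refine (Timed.fold_time' (M := N ^ 6) (fun b s _ => ?_) acc).trans
      (mul_le_pow hb.stateList_length (one_add_le_pow hb.two_le le_rfl))
    have h1 : (isPositive ω (G.P t x.1 a s).toReal).time ≤ N ^ 3 :=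
      hb.numSize_pow (hb.P_le t ht _ a s)
    have h2 := hb.nodeSize_le (x := (s, x.2 + c)) (hb.numSize_next ht hx hc)
    rw [Timed.bind_time]
    refine le_trans ?_ (add_le_pow hb.two_le h1 h2)
    split_ifs <;> simp
  constructor
  · refine (Timed.fold_time' (M := N ^ 15) (fun b c hc => ?_) _).trans
      (mul_le_pow (hb.costs_length ht _ _) (one_add_le_pow hb.two_le le_rfl))
    rw [Finset.mem_toList] at hc
    exact add_le_pow hb.two_le (hb.addCost_time ht hx hc) (hinner b c hc)
  -- Every cost contributes at most one child per state, whatever the accumulator.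
  · have hlen : ∀ (l : List (Fin G.n → ℝ)) (acc : List G.Node),
        (Timed.fold (fun acc c => do
          let c' ← addCost ω x.2 c
          Timed.fold (fun acc s => do
            let b ← isPositive ω (G.P t x.1 a s).toReal
            if b then do
              Timed.tick (nodeSize (G := G) ω (s, c'))
              pure ((s, c') :: acc)
            else pure acc) acc G.stateList) acc l).val.length ≤
          acc.length + l.length * G.stateList.length := by
      intro l
      induction l with
      | nil => intro acc; simp
      | cons c l ih =>
        intro acc
        rw [Timed.fold_cons_val]
        refine (ih _).trans ?_
        have h : ∀ (l' : List (Fin G.S)) (c' : Fin G.n → ℝ) (acc : List G.Node),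
            (Timed.fold (fun acc s => do
              let b ← isPositive ω (G.P t x.1 a s).toReal
              if b then do
                Timed.tick (nodeSize (G := G) ω (s, c'))
                pure ((s, c') :: acc)
              else pure acc) acc l').val.length ≤ acc.length + l'.length := by
          intro l' c'
          induction l' with
          | nil => intro acc; simp
          | cons s l' ih =>
            intro acc
            rw [Timed.fold_cons_val]
            refine (ih _).trans ?_
            rw [Timed.bind_val]
            split_ifs
            · simp only [Timed.bind_val, Timed.pure_val, List.length_cons]; omega
            · simp
        have := h G.stateList (x.2 + c) acc
        rw [List.length_cons, add_mul, one_mul]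
        rw [Timed.bind_val]
        change List.length (Timed.val (Timed.fold _ acc G.stateList)) + _ ≤ _
        refine (Nat.add_le_add_right this _).trans (by omega)
    refine (hlen _ _).trans ?_
    rw [List.length_nil, zero_add]
    exact mul_le_pow (hb.costs_length ht _ _) hb.stateList_length

theorem memList_time (hb : G.Bound ω N) {t : ℕ} (ht : t ≤ G.H) {x : G.Node}
    (hx : G.Reach (fun _ _ _ => True) t x) {L : List G.Node} (hL : IsLayer G t L) :
    (memList ω x L).time ≤ N ^ 17 := by
  refine (Timed.any_time (M := N ^ 14) fun y hy => ?_).trans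
    (mul_le_pow (hb.layer_length ht hL) (one_add_le_pow hb.two_le le_rfl))
  exact hb.vector_time (hb.numSize_node ht hx)
    (hb.numSize_node ht ((hL.2 y hy).mono fun _ _ _ _ => trivial))

theorem insertList_time (hb : G.Bound ω N) {t : ℕ} (ht : t ≤ G.H) {x : G.Node}
    (hx : G.Reach G.Affordable t x) {L : List G.Node} (hL : IsLayer G t L) :
    (insertList ω L x).time ≤ N ^ 18 ∧ IsLayer G t (insertList ω L x).val := by
  have hx' : G.Reach (fun _ _ _ => True) t x := hx.mono fun _ _ _ _ => trivial
  constructor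
  · rw [insertList, Timed.bind_time]
    refine le_trans ?_ (add_le_pow hb.two_le (hb.memList_time ht hx' hL)
      (hb.nodeSize_le (hb.numSize_node ht hx')))
    split_ifs <;> simp
  · refine ⟨?_, fun y hy => ?_⟩
    · rw [insertList, Timed.bind_val]
      split_ifs with h
      · exact hL.1
      · rw [memList_val] at h
        exact List.nodup_cons.2 ⟨h, hL.1⟩
    · rcases (mem_insertList ω L x y).1 hy with h | rfl
      · exact hL.2 y h
      · exact hx

/-- The invariant that the accumulator is a duplicate-free part of the next layer keeps its length
below `N ^ 2`, and so every insertion cheap. Passing actions must be affordable for the children to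
stay in the graph. -/
theorem expand_time (hb : G.Bound ω N) {t : ℕ} (ht : t < G.H)
    {ok : G.Node → Joint G.k → Timed Bool} {L : List G.Node} (hL : IsLayer G t L)
    (hok : ∀ x, G.Reach G.Affordable t x → ∀ a, (ok x a).time ≤ N ^ 23 ∧
      ((ok x a).val = true → G.Affordable t x a)) :
    (G.expand ω t ok L).time ≤ N ^ 30 ∧ IsLayer G (t + 1) (G.expand ω t ok L).val := by
  have h1 : ∀ acc x, x ∈ L → IsLayer G (t + 1) acc → ∀ a,
      (do
        let b ← ok x a
        if b then do
          let ys ← G.children ω t x a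
          Timed.fold (insertList ω) acc ys
        else pure acc : Timed (List G.Node)).time ≤ N ^ 24 ∧ IsLayer G (t + 1) (do
        let b ← ok x a
        if b then do
          let ys ← G.children ω t x a
          Timed.fold (insertList ω) acc ys
        else pure acc : Timed (List G.Node)).val := by
    intro acc x hx hacc a
    have hx := hL.2 x hx
    have hx' : G.Reach (fun _ _ _ => True) t x := hx.mono fun _ _ _ _ => trivial
    obtain ⟨ht1, ha⟩ := hok x hx a
    obtain ⟨hc1, hc2⟩ := hb.children_time ht hx' a
    rw [Timed.bind_time, Timed.bind_val]
    split_ifs with h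
    · have h2 := Timed.fold_time (f := insertList ω) (I := IsLayer G (t + 1)) (M := N ^ 18)
        (l := (G.children ω t x a).val) (fun b y hy hb' => by
          obtain ⟨c, hc, s, hs, rfl⟩ := (mem_children ω t x a y).1 hy
          exact hb.insertList_time (Nat.succ_le_of_lt ht) (.step hx (ha h) hc hs) hb') hacc
      refine ⟨?_, h2.2⟩
      rw [Timed.bind_time]
      exact pow_mono_of_two_le hb.two_le (add_le_pow hb.two_le ht1 (add_le_pow hb.two_le hc1
        (h2.1.trans (mul_le_pow hc2 (one_add_le_pow hb.two_le le_rfl))))) (by norm_num)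
    · exact ⟨pow_mono_of_two_le hb.two_le (by simpa using ht1) (by norm_num), hacc⟩
  have h2 := Timed.fold_time (I := IsLayer G (t + 1)) (M := N ^ 26) (l := L)
    (fun acc x hx hacc => by
      have := Timed.fold_time (l := G.jointList)
        (fun acc a _ hacc => h1 acc x hx hacc a) hacc
      exact ⟨this.1.trans (mul_le_pow (hb.jointList_length ht)
        (one_add_le_pow hb.two_le le_rfl)), this.2⟩)
    (show IsLayer G (t + 1) [] from ⟨List.nodup_nil, by simp⟩)
  exact ⟨pow_mono_of_two_le hb.two_le (h2.1.trans (mul_le_pow (hb.layer_length ht.le hL)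
    (one_add_le_pow hb.two_le le_rfl))) (by norm_num), h2.2⟩

theorem trueAction_time (hb : G.Bound ω N) {t : ℕ} (ht : t < G.H) {x : G.Node}
    (hx : G.Reach G.Affordable t x) {T : List G.Node} (hT : IsLayer G (t + 1) T)
    (a : Joint G.k) : (G.trueAction ω t T x a).time ≤ N ^ 23 ∧
      ((G.trueAction ω t T x a).val = true → G.Affordable t x a) := by
  have hx' : G.Reach (fun _ _ _ => True) t x := hx.mono fun _ _ _ _ => trivial
  have h1 := hb.feasibleAction_time ht hx' a
  obtain ⟨hc1, hc2⟩ := hb.children_time ht hx' a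
  rw [trueAction, Timed.bind_time, Timed.bind_val]
  split_ifs with h
  · refine ⟨?_, fun _ => (feasibleAction_val ω t x a).1 h⟩
    have h2 : (Timed.all (fun y => memList ω y T) (G.children ω t x a).val).time ≤ N ^ (2 + 18) :=
      (Timed.all_time (M := N ^ 17) fun y hy => by
        obtain ⟨c, hc, s, hs, rfl⟩ := (mem_children ω t x a y).1 hy
        exact hb.memList_time (Nat.succ_le_of_lt ht) (.step hx' trivial hc hs) hT).trans
        (mul_le_pow hc2 (one_add_le_pow hb.two_le le_rfl))
    rw [Timed.bind_time]
    exact pow_mono_of_two_le hb.two_le (add_le_pow hb.two_le h1 (add_le_pow hb.two_le hc1 h2))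
      (by norm_num)
  · exact ⟨pow_mono_of_two_le hb.two_le (by simpa using h1) (by norm_num), fun h' => by simp at h'⟩

end Bound

end ACMG

/-! ### Running times of the passes and size of the reduced game. -/

namespace ACMG

namespace Bound

variable {G : ACMG} {ω : CostModel} {N : ℕ}

theorem forward_time (hb : G.Bound ω N) {m t : ℕ} (hm : t + m ≤ G.H) {L : List G.Node}
    (hL : IsLayer G t L) :
    (G.forward ω m t L).time ≤ m * N ^ 30 ∧ AreLayers G t (G.forward ω m t L).val := by
  induction m generalizing t L with
  | zero => exact ⟨by simp [forward], hL, trivial⟩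
  | succ m ih =>
    obtain ⟨h1, h2⟩ := hb.expand_time (ok := G.feasibleAction ω t) (by omega) hL
      fun x hx a => ⟨pow_mono_of_two_le hb.two_le
        (hb.feasibleAction_time (by omega) (hx.mono fun _ _ _ _ => trivial) a) (by norm_num),
        (feasibleAction_val ω t x a).1⟩
    obtain ⟨h3, h4⟩ := ih (by omega) h2
    refine ⟨?_, hL, h4⟩
    simp only [forward, Timed.bind_time, Timed.pure_time]
    rw [add_mul, one_mul]
    omega

theorem IsLayer.filter {t : ℕ} {L : List G.Node} (hL : IsLayer G t L) (p : G.Node → Bool) :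
    IsLayer G t (L.filter p) :=
  ⟨hL.1.filter _, fun x hx => hL.2 x (List.mem_of_mem_filter hx)⟩

theorem evaluate_time (hb : G.Bound ω N) {t : ℕ} {Ls : List (List G.Node)}
    (hl : t + Ls.length ≤ G.H + 1) (hL : AreLayers G t Ls) :
    (G.evaluate ω t Ls).time ≤ Ls.length * N ^ 30 ∧ AreLayers G t (G.evaluate ω t Ls).val := by
  induction Ls generalizing t with
  | nil => exact ⟨by simp [evaluate], trivial⟩
  | cons L Ls ih =>
    cases Ls with
    | nil => exact ⟨by simp [evaluate], hL⟩
    | cons L' Ls =>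
      simp only [List.length_cons] at hl
      obtain ⟨h1, h2⟩ := ih (t := t + 1) (by simp only [List.length_cons]; omega) hL.2
      rw [evaluate_cons]
      simp only [Timed.bind_time, Timed.bind_val, Timed.pure_time, Timed.pure_val]
      have hhead : IsLayer G (t + 1) ((G.evaluate ω (t + 1) (L' :: Ls)).val.headD []) := by
        have := h2.getD 0
        revert this
        cases (G.evaluate ω (t + 1) (L' :: Ls)).val <;> exact id
      refine ⟨?_, ?_, h2⟩
      · have h3 := Timed.filter_time (M := N ^ 25) (p := fun x => Timed.any (fun a =>
          G.trueAction ω t ((G.evaluate ω (t + 1) (L' :: Ls)).val.headD []) x a) G.jointList)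
          (l := L) fun x hx => (Timed.any_time (M := N ^ 23) fun a _ =>
            (hb.trueAction_time (by omega) (hL.1.2 x hx) hhead a).1).trans
              (mul_le_pow (hb.jointList_length (t := t) (by omega))
                (one_add_le_pow hb.two_le le_rfl))
        have h4 := pow_mono_of_two_le hb.two_le (h3.trans (mul_le_pow
          (hb.layer_length (t := t) (by omega) hL.1) (one_add_le_pow hb.two_le le_rfl)))
          (show 2 + (25 + 1) ≤ 30 by norm_num)
        rw [List.length_cons, add_mul, one_mul]
        omega
      · rw [Timed.filter_val]
        exact hL.1.filter _

theorem prune_time (hb : G.Bound ω N) {t : ℕ} {L : List G.Node} {Ts : List (List G.Node)}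
    (hl : t + Ts.length ≤ G.H) (hL : IsLayer G t L) (hT : AreLayers G (t + 1) Ts) :
    (G.prune ω t L Ts).time ≤ Ts.length * N ^ 30 ∧ AreLayers G t (G.prune ω t L Ts).val := by
  induction Ts generalizing t L with
  | nil => exact ⟨by simp [prune], hL, trivial⟩
  | cons T Ts ih =>
    rw [List.length_cons] at hl
    obtain ⟨h1, h2⟩ := hb.expand_time (ok := G.trueAction ω t T) (by omega) hL
      fun x hx a => hb.trueAction_time (by omega) hx hT.1 a
    obtain ⟨h3, h4⟩ := ih (by omega) h2 hT.2
    refine ⟨?_, hL, h4⟩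
    simp only [prune, Timed.bind_time, Timed.pure_time]
    rw [List.length_cons, add_mul, one_mul]
    omega

theorem areLayers_layers (hb : G.Bound ω N) : AreLayers G 0 (G.layers ω) :=
  (hb.forward_time (by omega) isLayer_root).2

theorem areLayers_trueLayers (hb : G.Bound ω N) : AreLayers G 0 (G.trueLayers ω) :=
  (hb.evaluate_time (by rw [layers_length]; omega) hb.areLayers_layers).2

theorem areLayers_tail {t : ℕ} {Ls : List (List G.Node)} (h : AreLayers G t Ls) :
    AreLayers G (t + 1) Ls.tail := by
  cases Ls with
  | nil => trivial
  | cons L Ls => exact h.2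

theorem prunedLayers_time (hb : G.Bound ω N) :
    (G.prune ω 0 [(G.s₁, 0)] (G.trueLayers ω).tail).time ≤ N ^ 31 ∧
      AreLayers G 0 (G.prunedLayers ω) := by
  have hl : (G.trueLayers ω).tail.length = G.H := by
    rw [List.length_tail, trueLayers_length]; omega
  obtain ⟨h1, h2⟩ := hb.prune_time (by omega) isLayer_root (areLayers_tail hb.areLayers_trueLayers)
  rw [hl] at h1
  exact ⟨h1.trans (mul_le_pow (a := 1) (by simpa using hb.H_le) le_rfl), h2⟩

theorem range_length (hb : G.Bound ω N) : (List.range G.H).length ≤ N ^ 1 := by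
  simpa using hb.H_le

theorem isLayer_RS (hb : G.Bound ω N) (t : ℕ) : IsLayer G t ((G.feasibleSets ω).RS t) := by
  have := hb.prunedLayers_time.2.getD t
  rwa [zero_add] at this

theorem actionTable_time (hb : G.Bound ω N) : (G.actionTable ω).time ≤ N ^ 30 := by
  refine (Timed.tabulate_time (M := N ^ 28) fun t ht => ?_).trans
    (mul_le_pow hb.range_length (one_add_le_pow hb.two_le le_rfl))
  rw [List.mem_range] at ht
  refine (Timed.tabulate_time (M := N ^ 25) fun x hx => ?_).trans
    (mul_le_pow (hb.layer_length ht.le (hb.isLayer_RS t)) (one_add_le_pow hb.two_le le_rfl))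
  refine (Timed.filter_time (M := N ^ 23) fun a _ => ?_).trans
    (mul_le_pow (hb.jointList_length ht) (one_add_le_pow hb.two_le le_rfl))
  have hT := hb.areLayers_trueLayers.getD (t + 1)
  rw [zero_add] at hT
  exact (hb.trueAction_time ht ((hb.isLayer_RS t).2 x hx) hT a).1

theorem feasibility_time (hb : G.Bound ω N) : (G.feasibility ω).time ≤ N ^ 40 := by
  have h1 : (G.forward ω G.H 0 [(G.s₁, 0)]).time ≤ N ^ 31 :=
    (hb.forward_time (by omega) isLayer_root).1.trans
      (mul_le_pow (a := 1) (by simpa using hb.H_le) le_rfl)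
  have h2 : (G.evaluate ω 0 (G.layers ω)).time ≤ N ^ 32 := by
    refine (hb.evaluate_time (by rw [layers_length]; omega) hb.areLayers_layers).1.trans
      (mul_le_pow (a := 2) ?_ le_rfl)
    rw [layers_length, add_comm]
    exact one_add_le_pow hb.two_le (by simpa using hb.H_le)
  have hhead : IsLayer G 0 ((G.trueLayers ω).headD []) := by
    have := hb.areLayers_trueLayers.getD 0
    revert this
    cases G.trueLayers ω <;> exact id
  have h3 := hb.memList_time (Nat.zero_le _) (x := (G.s₁, 0)) .root hhead
  have h4 := hb.prunedLayers_time.1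
  have h5 := hb.actionTable_time
  have h6 := add_le_pow hb.two_le h1 (add_le_pow hb.two_le h2 (add_le_pow hb.two_le h3
    (add_le_pow hb.two_le h4 h5)))
  refine pow_mono_of_two_le hb.two_le (le_trans ?_ h6) (by norm_num)
  rw [feasibility_eq]
  simp only [Timed.bind_time]
  split_ifs
  · simp only [Timed.bind_time, Timed.pure_time]
    omega
  · simp only [Timed.pure_time]
    omega

theorem numSize_product (hb : G.Bound ω N) {t : ℕ} (ht : t < G.H) {s : Fin G.S} {a : Joint G.k}
    {c : Fin G.n → ℝ} (hc : c ∈ G.costs t s a) (s' : Fin G.S) :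
    ω.numSize ((G.C t s a c).toReal * (G.P t s a s').toReal) ≤ N ^ 2 := by
  refine (ω.numSize_mul_le (hb.C_stored t ht s a c hc) (hb.P_stored t ht s a s')).trans ?_
  exact add_le_pow (a := 1) (b := 1) hb.two_le (by simpa using hb.C_le t ht s a c hc)
    (by simpa using hb.P_le t ht s a s')

theorem transRow_time (hb : G.Bound ω N) {t : ℕ} (ht : t < G.H) {x : G.Node}
    (hx : G.Reach (fun _ _ _ => True) t x) (a : Joint G.k) :
    (G.transRow ω t x a).time ≤ N ^ 30 := by
  have hinner : ∀ (w : G.Node →₀ ℝ) (c : Fin G.n → ℝ), c ∈ G.costs t x.1 a →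
      (Timed.fold (fun w s => do
        let p ← mulNum ω (G.C t x.1 a c).toReal (G.P t x.1 a s).toReal
        Timed.tick (nodeSize (G := G) ω (s, x.2 + c) + ω.numSize p)
        pure (w + Finsupp.single (s, x.2 + c) p)) w G.stateList).time ≤ N ^ 15 := by
    intro w c hc
    refine (Timed.fold_time' (M := N ^ 13) (fun b s _ => ?_) w).trans
      (mul_le_pow hb.stateList_length (one_add_le_pow hb.two_le le_rfl))
    have h1 : ω.opCost (G.C t x.1 a c).toReal (G.P t x.1 a s).toReal ≤ N ^ 12 := by
      refine (Nat.pow_le_pow_left (add_le_pow hb.two_le (hb.numSize_pow (hb.C_le t ht _ a c hc))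
        (hb.numSize_pow (hb.P_le t ht _ a s))) 3).trans ?_
      rw [← pow_mul]
      norm_num
    have h2 := hb.nodeSize_le (x := (s, x.2 + c)) (hb.numSize_next ht hx hc)
    exact add_le_pow hb.two_le h1 (add_le_pow hb.two_le h2 (hb.numSize_product ht hc s))
  refine pow_mono_of_two_le hb.two_le ((Timed.fold_time' (M := N ^ 16) (fun b c hc => ?_) _).trans
    (mul_le_pow (hb.costs_length ht _ _) (one_add_le_pow hb.two_le le_rfl))) (by norm_num)
  rw [Finset.mem_toList] at hc
  exact add_le_pow hb.two_le (hb.addCost_time ht hx hc) (hinner b c hc)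

theorem rewardRow_time (hb : G.Bound ω N) {t : ℕ} (ht : t < G.H) (x : G.Node) (a : Joint G.k) :
    (G.rewardRow ω t x a).time ≤ N ^ 30 :=
  pow_mono_of_two_le hb.two_le (one_add_le_pow hb.two_le
    (hb.sum_fin_le fun i => hb.numSize_pow (hb.r_le t ht x.1 a i))) (by norm_num)

theorem RA_length (hb : G.Bound ω N) {t : ℕ} (ht : t < G.H) {x : G.Node}
    (hx : x ∈ (G.feasibleSets ω).RS t) : ((G.feasibleSets ω).RA t x).length ≤ N ^ 1 := by
  refine le_trans ?_ (hb.jointList_length ht)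
  simp only [feasibleSets, actionTable, Timed.tabulate_val]
  rw [if_pos (List.mem_range.2 ht), Timed.tabulate_val,
    if_pos (show x ∈ (G.prunedLayers ω).getD t [] from hx), Timed.filter_val]
  exact List.length_filter_le _ _

/-- Serves the transition and the reward table alike, since both have the same index set. -/
theorem rows_time (hb : G.Bound ω N) {β : Type} {d : β} {f : ℕ → G.Node → Joint G.k → Timed β}
    (hf : ∀ t < G.H, ∀ x, G.Reach G.Affordable t x → ∀ a, (f t x a).time ≤ N ^ 30) :
    (Timed.tabulate (fun _ _ => d) (fun t => Timed.tabulate (fun _ => d) (fun x =>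
      Timed.tabulate d (f t x) ((G.feasibleSets ω).RA t x)) ((G.feasibleSets ω).RS t))
        (List.range G.H)).time ≤ N ^ 37 := by
  refine (Timed.tabulate_time (M := N ^ 35) fun t ht => ?_).trans
    (mul_le_pow hb.range_length (one_add_le_pow hb.two_le le_rfl))
  rw [List.mem_range] at ht
  refine (Timed.tabulate_time (M := N ^ 32) fun x hx => ?_).trans
    (mul_le_pow (hb.layer_length ht.le (hb.isLayer_RS t)) (one_add_le_pow hb.two_le le_rfl))
  exact (Timed.tabulate_time fun a _ => hf t ht x ((hb.isLayer_RS t).2 x hx) a).trans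
    (mul_le_pow (hb.RA_length ht hx) (one_add_le_pow hb.two_le le_rfl))

theorem construct_time (hb : G.Bound ω N) :
    (G.construct ω (G.feasibleSets ω)).time ≤ N ^ 38 := by
  simp only [construct, Timed.bind_time, Timed.pure_time, add_zero]
  exact add_le_pow hb.two_le
    (hb.rows_time fun t ht x hx a => hb.transRow_time ht (hx.mono fun _ _ _ _ => trivial) a)
    (hb.rows_time fun t ht x _ a => hb.rewardRow_time ht x a)

theorem transTable_size (hb : G.Bound ω N) {t : ℕ} (ht : t < G.H) (x : G.Node) (a : Joint G.k) :
    ((G.transTable t x a).sum fun _ p => ω.numSize p) ≤ N ^ 4 := by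
  classical
  refine sum_le_pow (a := 2) (b := 2) ?_ fun y hy => ?_
  · have hsub : (G.transTable t x a).support ⊆
        (Finset.univ ×ˢ G.costs t x.1 a).image fun p => (p.1, x.2 + p.2) := by
      intro y hy
      obtain ⟨h1, -⟩ := transTable_support hy
      exact Finset.mem_image.2 ⟨(y.1, y.2 - x.2), by simpa using h1, by simp⟩
    refine ((Finset.card_le_card hsub).trans Finset.card_image_le).trans ?_
    rw [Finset.card_product]
    exact mul_le_pow (a := 1) (b := 1) (by simpa using hb.S_le)
      (by simpa using hb.costs_le t ht x.1 a)
  · rw [transTable_apply]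
    exact hb.numSize_product ht (transTable_support hy).1 _

/-- Converts the solver's bound, which is in terms of the reduced game, into one in terms of |G| and
D. -/
theorem reduced_size (hb : G.Bound ω N) (h0 : G.Live G.H 0 (G.s₁, 0)) :
    G.reducedTables.game.size ω ≤ N ^ 20 := by
  have hN := hb.two_le
  have hone : ∀ {x : ℕ}, x ≤ N → x ≤ N ^ 1 := fun h => by simpa using h
  have hcard : ∀ t ≤ G.H, (G.reducedTables.states t).card ≤ N ^ 2 := fun t ht =>
    hb.card_le t ht _ fun x hx =>
      ((mem_reduced_states h0 ht x).1 hx).mono fun _ _ _ h => h.affordable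
  have h1 : ∑ t ∈ Finset.range (G.H + 1), (G.reducedTables.states t).card ≤ N ^ (2 + 2) := by
    refine sum_le_pow ?_ fun t ht => hcard t (Nat.lt_succ_iff.1 (Finset.mem_range.1 ht))
    rw [Finset.card_range, add_comm]
    exact one_add_le_pow hN (hone hb.H_le)
  have h2 : ∑ t ∈ Finset.range G.H, ∑ x ∈ G.reducedTables.states t,
      (Fintype.card (Joint G.k) + ∑ a ∈ G.reducedTables.acts t x,
        (∑ i, ω.numSize (G.reducedTables.r t x a i) +
          (G.reducedTables.trans t x a).sum fun _ p => ω.numSize p)) ≤ N ^ (1 + (2 + 8)) := by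
    refine sum_le_pow (by simpa using hb.H_le) fun t ht => ?_
    rw [Finset.mem_range] at ht
    refine sum_le_pow (hcard t ht.le) fun x _ => ?_
    refine add_le_pow (a := 1) (b := 7) hN (hone (hb.joint_le t ht)) ?_
    refine sum_le_pow (a := 1) (b := 6)
      ((Finset.card_le_univ _).trans (hone (hb.joint_le t ht))) fun a ha => ?_
    obtain ⟨hx, ha⟩ := (mem_reduced_acts h0 ht x a).1 ha
    have htr : G.reducedTables.trans t x a = G.transTable t x a := reduced_trans h0 ht hx ha
    rw [htr, reduced_r h0 ht hx ha]
    exact pow_mono_of_two_le hN (add_le_pow hN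
      (hb.sum_fin_le fun i => hb.numSize_pow (hb.r_le t ht x.1 a i))
      (hb.transTable_size ht x a)) (by norm_num)
  exact pow_mono_of_two_le hN (add_le_pow hN (add_le_pow hN (add_le_pow hN (add_le_pow hN
    (hone hb.H_le) (hone hb.n_le)) (hone hb.k_le)) h1) h2) (by norm_num)

end Bound

end ACMG

/-! ### The main theorem. -/

theorem Polynomial.eval_mono_nat (p : Polynomial ℕ) {a b : ℕ} (h : a ≤ b) :
    p.eval a ≤ p.eval b := by
  rw [Polynomial.eval_eq_sum_range, Polynomial.eval_eq_sum_range]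
  exact Finset.sum_le_sum fun i _ => Nat.mul_le_mul_left _ (Nat.pow_le_pow_left h i)

theorem mainTheorem1 (ω : CostModel) (MGSolve : (Γ : ACGame) → Timed Γ.Policy) (𝒦 : Set ACGame) :
    -- correctness
    (∀ kind : Play.Kind,
      (∀ Γ ∈ 𝒦, Γ.WellFormed → Γ.Feasible → Γ.IsMPE kind (MGSolve Γ).val) →
      ∀ G : ACMG,
        (G.feasiblePolicies = ∅ → (ACMG.reduction ω MGSolve G).val = none) ∧
        (G.feasiblePolicies ≠ ∅ → G.reducedGame ∈ 𝒦 →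
          ∃ o : G.Output, (ACMG.reduction ω MGSolve G).val = some o ∧ G.IsACSPE kind o.policy)) ∧
    -- running time
    (∀ p : Polynomial ℕ,
      (∀ Γ ∈ 𝒦, Γ.WellFormed → Γ.Feasible → (MGSolve Γ).time ≤ p.eval (Γ.size ω)) →
      ∃ q : MvPolynomial (Fin 2) ℕ, ∀ G : ACMG, G.StoredIn ω →
        (G.feasiblePolicies ≠ ∅ → G.reducedGame ∈ 𝒦) →
        (ACMG.reduction ω MGSolve G).time ≤ MvPolynomial.eval ![G.size ω, G.D] q) ∧
    -- space
    (∀ (G : ACMG) (o : G.Output), (ACMG.reduction ω MGSolve G).val = some o →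
      o.space ≤ G.H * G.S * Fintype.card (Joint G.k) * G.D) := by
  refine ⟨fun kind hsolve G => ⟨fun h => ?_, fun h hK => ?_⟩, fun p hp => ?_, fun G o ho => ?_⟩
  · refine (ACMG.reduction_eq_of_not_live ω MGSolve fun h0 => ?_).1
    exact G.feasiblePolicies_ne_empty.2 h0 h
  · have h0 := G.feasiblePolicies_ne_empty.1 h
    refine ⟨_, (ACMG.reduction_eq_of_live ω MGSolve h0).1, ?_⟩
    -- The reduced game and the output policy unfold to `reducedTables.toGame` and its `lookup`, so
    -- no rewriting is needed.
    exact ACMG.isACSPE_of_isMPE h0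
      (hsolve _ hK (ACMG.reduced_wellFormed h0) (ACMG.reduced_feasible h0))
  · let N : MvPolynomial (Fin 2) ℕ := MvPolynomial.X 0 + MvPolynomial.X 1 + 16
    -- `N ^ 41` pays for feasibility (`N ^ 40`) and construction (`N ^ 38`); `N ^ 20` bounds the
    -- size of the game given to the solver.
    refine ⟨N ^ 41 + Polynomial.aeval (N ^ 20) p, fun G hG hK => ?_⟩
    have hN : MvPolynomial.eval ![G.size ω, G.D] N = G.size ω + G.D + 16 := by simp [N]
    have hq : MvPolynomial.eval ![G.size ω, G.D] (N ^ 41 + Polynomial.aeval (N ^ 20) p) =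
        (G.size ω + G.D + 16) ^ 41 + p.eval ((G.size ω + G.D + 16) ^ 20) := by
      rw [map_add, map_pow, Polynomial.aeval_def, Polynomial.hom_eval₂, map_pow, hN,
        Subsingleton.elim ((MvPolynomial.eval ![G.size ω, G.D]).comp
          (algebraMap ℕ (MvPolynomial (Fin 2) ℕ))) (RingHom.id ℕ)]
      rfl
    rw [hq]
    have hb := ACMG.bound_of_stored hG
    generalize G.size ω + G.D + 16 = n at hb ⊢
    by_cases h0 : G.Live G.H 0 (G.s₁, 0)
    · rw [(ACMG.reduction_eq_of_live ω MGSolve h0).2]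
      refine Nat.add_le_add (add_le_pow (a := 40) hb.two_le hb.feasibility_time
        hb.construct_time) ?_
      exact (hp _ (hK (G.feasiblePolicies_ne_empty.2 h0)) (ACMG.reduced_wellFormed h0)
        (ACMG.reduced_feasible h0)).trans (p.eval_mono_nat (hb.reduced_size h0))
    · rw [(ACMG.reduction_eq_of_not_live ω MGSolve h0).2]
      exact (pow_mono_of_two_le hb.two_le hb.feasibility_time (by norm_num)).trans
        (Nat.le_add_right _ _)
  · by_cases h0 : G.Live G.H 0 (G.s₁, 0)
    · rw [(ACMG.reduction_eq_of_live ω MGSolve h0).1, Option.some.injEq] at ho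
      subst ho
      -- Only rounds before the horizon have rows, so the sharp bound `S * D` on the states applies
      -- to each of them.
      refine (Finset.sum_le_card_nsmul _ _ (G.S * G.D * Fintype.card (Joint G.k)) fun t ht =>
        Nat.mul_le_mul_right _
          (ACMG.card_reduced_states_le h0 (Finset.mem_range.1 ht))).trans_eq ?_
      rw [Finset.card_range, smul_eq_mul]
      ring
    · rw [(ACMG.reduction_eq_of_not_live ω MGSolve h0).1] at ho
      exact absurd ho (by simp)
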